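/- **Theorem (Adequacy).** Let $\Gamma$ be a typing context, $\sigma$ a type, and let $M,M'$ be terms of probabilistic PCF of type $\sigma$ in context $\Gamma$. If $[\![M]\!]_\Gamma=[\![M']\!]_\Gamma$ in the model of probabilistic coherence spaces, then $M$ and $M'$ are observationally equivalent. *Language.* Types are $\sigma ::= \mathsf{nat}\mid\sigma\Rightarrow\sigma$. Terms (up to renaming of bound variables) are $M ::= \underline n\mid x\mid\mathsf{succ}(M)\mid\mathsf{if}(M,P,z\cdot R)\mid\lambda x^\sigma M\mid (M)N\mid\mathsf{coin}(p)\mid\mathsf{fix}(M)$ with $n\in\mathbb N$, $p\in[0,1]\cap\mathbb Q$. A typing context is a finite sequence of declarations $x_i:\sigma_i$ with pairwise distinct variables. Typing is as in simply typed PCF: $\underline n,\mathsf{coin}(p):\mathsf{nat}$; $\mathsf{succ}(M):\mathsf{nat}$ if $M:\mathsf{nat}$; $\mathsf{if}(M,P,z\cdot R):\sigma$ if $M:\mathsf{nat}$, $P:\sigma$ and $R:\sigma$ with the extra variable $z:\mathsf{nat}$; $\mathsf{fix}(M):\sigma$ if $M:\sigma\Rightarrow\sigma$. *Reduction.* One-step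 weak-head reduction $M\to^pM'$ is generated by $(\lambda x^\sigma M)N\to^1M[N/x]$, $\mathsf{fix}(M)\to^1(M)\mathsf{fix}(M)$, $\mathsf{succ}(\underline n)\to^1\underline{n+1}$, $\mathsf{if}(\underline0,P,z\cdot R)\to^1P$, $\mathsf{if}(\underline{n+1},P,z\cdot R)\to^1R[\underline n/z]$, $\mathsf{coin}(p)\to^p\underline0$, $\mathsf{coin}(p)\to^{1-p}\underline1$, and closure under the evaluation positions $(\,\cdot\,)N$, $\mathsf{succ}(\cdot)$ and $\mathsf{if}(\cdot,P,z\cdot R)$. Let $\mathrm{Red}$ be the stochastic matrix on closed terms of type $\mathsf{nat}$ with $\mathrm{Red}_{M,M'}=p$ if $M\to^pM'$, $\mathrm{Red}_{M,M}=1$ if no reduction from $M$ is possible, and $0$ otherwise; put $\mathrm{Red}^\infty_{M,M'}=\sup_k(\mathrm{Red}^k)_{M,M'}$ if $\mathrm{Red}_{M',M'}=1$, and $0$ otherwise. *Observational equivalence.* An observation context is a typed term built with an additional constant, the hole, of type $\sigma$, which may occur in any typing context containing all the declarations of $\Gamma$; $C[M]$ is obtained by replacing all the holes by $M$, the binders of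 $C$ capturing the free variables of $M$ of the same name. The terms $M,M'$ are observationally equivalent if $\mathrm{Red}^\infty_{C[M],\underline0}=\mathrm{Red}^\infty_{C[M'],\underline0}$ for every closed observation context $C$ of type $\mathsf{nat}$. *Model.* For $u,u'\in\mathbb R_{\ge0}^I$ let $\langle u,u'\rangle=\sum_iu_iu'_i$, and for $\mathcal X\subseteq\mathbb R_{\ge0}^I$ let $\mathcal X^\perp=\{u'\mid\forall u\in\mathcal X\ \langle u,u'\rangle\le1\}$. A probabilistic coherence space is a pair $X=(|X|,\mathsf PX)$ with $|X|$ countable and $\mathsf PX=\mathsf PX^{\perp\perp}\subseteq\mathbb R_{\ge0}^{|X|}$ such that for every $a\in|X|$ the set $\{u_a\mid u\in\mathsf PX\}$ is bounded and contains a positive number. Morphisms $X\to Y$ are the matrices $t\in\mathbb R_{\ge0}^{|X|\times|Y|}$ mapping $\mathsf PX$ into $\mathsf PY$; they form the space $X\multimap Y$ with web $|X|\times|Y|$. The space $!X$ has as web the finite multisets on $|X|$, and $\mathsf P(!X)=\{u^!\mid u\in\mathsf PX\}^{\perp\perp}$ with $u^!_\mu=\prod_au_a^{\mu(a)}$; it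 carries the standard structure of exponential comonad, whose Kleisli category is cartesian closed with product $X\mathbin{\&}Y$ (disjoint union of webs) and internal hom $X\Rightarrow Y={!X}\multimap Y$. For $t:{!X}\to Y$ write $\hat t(u)_b=\sum_\mu t_{\mu,b}u^!_\mu$. One sets $[\![\mathsf{nat}]\!]=(\mathbb N,\{u\mid\sum_nu_n\le1\})$ and $[\![\sigma\Rightarrow\tau]\!]=[\![\sigma]\!]\Rightarrow[\![\tau]\!]$. For $\Gamma=(x_1:\sigma_1,\dots,x_k:\sigma_k)$, the interpretation $[\![M]\!]_\Gamma$ is a matrix that is a morphism ${!([\![\sigma_1]\!]\mathbin\&\cdots\mathbin\&[\![\sigma_k]\!])}\to[\![\sigma]\!]$, defined by induction on $M$ from the cartesian closed structure for variables, abstraction and application, the constants $\underline n\mapsto e_n$ and $\mathsf{coin}(p)\mapsto p\,e_0+(1-p)\,e_1$ (where $(e_n)_k=\delta_{n,k}$), the linear successor $e_n\mapsto e_{n+1}$, the least fix-point morphism $\sup_n\mathcal Y_n:(X\Rightarrow X)\to X$ of the Kleisli category, where $\mathcal Y_0=0$ and $\mathcal Y_{n+1}=\mathrm{Ev}\circ\langle\mathrm{Id},\mathcal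 Y_n\rangle$, and the conditional, characterized, with $v$ the interpretation of $P$ (the scrutinee) at $\vec u$, by $$\widehat{[\![\mathsf{if}(P,Q,z\cdot R)]\!]_\Gamma}(\vec u)=v_0\,\widehat{[\![Q]\!]_\Gamma}(\vec u)+\sum_{n\ge0}v_{n+1}\,\widehat{[\![R]\!]_{\Gamma,z:\mathsf{nat}}}(\vec u,e_n).$$ -/

import Mathlib

open scoped ENNReal NNReal

noncomputable section

namespace PPCF

/-! ### Vectors, pairing and orthogonality -/

/-- The pairing of two families of scalars. -/
def pairing {A : Type} (u v : A → ℝ≥0∞) : ℝ≥0∞ := ∑' a, u a * v a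

/-- The orthogonal of a set of families. Families of nonnegative reals are the families with values
in `ℝ≥0∞` that never take the value `∞`. -/
def orth {A : Type} (S : Set (A → ℝ≥0∞)) : Set (A → ℝ≥0∞) :=
  {v | (∀ a, v a ≠ ∞) ∧ ∀ u ∈ S, pairing u v ≤ 1}

/-- Probabilistic coherence spaces. -/
structure PCS where
  Web : Type
  countable_web : Countable Web
  coh : Set (Web → ℝ≥0∞)
  biorth : orth (orth coh) = coh
  cover : ∀ a, ∃ u ∈ coh, 0 < u a
  bounded : ∀ a, ∃ A : ℝ≥0, 0 < A ∧ ∀ u ∈ coh, u a ≤ A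

open Classical in
/-- The Kronecker symbol. -/
def kron {A : Type} (a b : A) : ℝ≥0∞ := if a = b then 1 else 0

theorem pairing_comm {A : Type} (u v : A → ℝ≥0∞) : pairing u v = pairing v u := by
  simp only [pairing, mul_comm]

theorem kron_self {A : Type} (a : A) : kron a a = 1 := by simp [kron]

theorem tsum_kron {A : Type} (a : A) (f : A → ℝ≥0∞) : ∑' x, kron x a * f x = f a := by
  rw [tsum_eq_single a]
  · simp [kron]
  · intro b hb; simp [kron, hb]

theorem tsum_kron' {A : Type} (a : A) (f : A → ℝ≥0∞) : ∑' x, kron a x * f x = f a := by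
  rw [tsum_eq_single a]
  · simp [kron]
  · intro b hb; simp [kron, hb.symm]

theorem le_inv_of_pairing {A : Type} {u v : A → ℝ≥0∞} (h : pairing u v ≤ 1) (a : A) :
    v a ≤ (u a)⁻¹ := by
  rw [ENNReal.le_inv_iff_mul_le, mul_comm]
  exact (ENNReal.le_tsum a).trans h

theorem scaled_kron_mem_orth {A : Type} {S : Set (A → ℝ≥0∞)} (a : A) {c : ℝ≥0∞} (hc : c ≠ 0)
    (h : ∀ s ∈ S, s a ≤ c) : (fun x => kron x a * c⁻¹) ∈ orth S := by
  refine ⟨fun x => ?_, fun s hs => ?_⟩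
  · refine ENNReal.mul_ne_top ?_ (ENNReal.inv_ne_top.2 hc)
    unfold kron; split_ifs <;> simp
  · have : pairing s (fun x => kron x a * c⁻¹) = s a * c⁻¹ := by
      rw [← tsum_kron a (fun x => s x * c⁻¹)]
      exact tsum_congr fun x => by ring
    rw [this, ← div_eq_mul_inv]
    exact ENNReal.div_le_of_le_mul (by simpa using h s hs)

theorem triorth {A : Type} {S : Set (A → ℝ≥0∞)} (hfin : ∀ s ∈ S, ∀ a, s a ≠ ∞) :
    orth (orth (orth S)) = orth S := by
  ext v
  constructor
  · rintro ⟨h1, h2⟩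
    exact ⟨h1, fun u hu => h2 u ⟨hfin u hu, fun w hw => by
      rw [pairing_comm]; exact hw.2 u hu⟩⟩
  · rintro ⟨h1, h2⟩
    exact ⟨h1, fun u hu => by rw [pairing_comm]; exact hu.2 v ⟨h1, h2⟩⟩

/-- A set of families that is the orthogonal of a pointwise bounded, covering set of families is a
probabilistic coherence space. -/
abbrev PCS.ofOrth {A : Type} (hA : Countable A) (C S : Set (A → ℝ≥0∞)) (hC : C = orth S)
    (hbdd : ∀ a, ∃ c : ℝ≥0, 0 < c ∧ ∀ s ∈ S, s a ≤ c) (hcov : ∀ a, ∃ s ∈ S, 0 < s a) : PCS where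
  Web := A
  countable_web := hA
  coh := C
  biorth := by
    rw [hC]
    refine triorth fun s hs a => ?_
    obtain ⟨c, -, hc⟩ := hbdd a
    exact ne_top_of_le_ne_top ENNReal.coe_ne_top (hc s hs)
  cover a := by
    obtain ⟨c, hc0, hc⟩ := hbdd a
    rw [hC]
    refine ⟨_, scaled_kron_mem_orth a (c := c) (by simpa using hc0.ne') hc, ?_⟩
    simp [kron_self]
  bounded a := by
    obtain ⟨s, hs, hs0⟩ := hcov a
    obtain ⟨c, hc0, hc⟩ := hbdd a
    have hst : s a ≠ ∞ := ne_top_of_le_ne_top ENNReal.coe_ne_top (hc s hs)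
    refine ⟨(s a)⁻¹.toNNReal, ?_, fun u hu => ?_⟩
    · exact ENNReal.toNNReal_pos (ENNReal.inv_ne_zero.2 hst) (ENNReal.inv_ne_top.2 hs0.ne')
    · rw [ENNReal.coe_toNNReal (ENNReal.inv_ne_top.2 hs0.ne')]
      rw [hC] at hu
      exact le_inv_of_pairing (hu.2 s hs) a

theorem PCS.ne_top (X : PCS) {u : X.Web → ℝ≥0∞} (hu : u ∈ X.coh) (a : X.Web) : u a ≠ ∞ := by
  rw [← X.biorth] at hu
  exact hu.1 a

theorem PCS.orth_bounded (X : PCS) (a : X.Web) :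
    ∃ c : ℝ≥0, 0 < c ∧ ∀ v ∈ orth X.coh, v a ≤ c := by
  obtain ⟨u, hu, h0⟩ := X.cover a
  refine ⟨(u a)⁻¹.toNNReal, ?_, fun v hv => ?_⟩
  · exact ENNReal.toNNReal_pos (ENNReal.inv_ne_zero.2 (X.ne_top hu a)) (ENNReal.inv_ne_top.2 h0.ne')
  · rw [ENNReal.coe_toNNReal (ENNReal.inv_ne_top.2 h0.ne')]
    exact le_inv_of_pairing (hv.2 u hu) a

theorem PCS.orth_cover (X : PCS) (a : X.Web) : ∃ v ∈ orth X.coh, 0 < v a := by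
  obtain ⟨c, hc0, hc⟩ := X.bounded a
  refine ⟨_, scaled_kron_mem_orth a (c := c) (by simpa using hc0.ne') hc, ?_⟩
  simp [kron_self]

theorem PCS.mem_coh_iff (X : PCS) (u : X.Web → ℝ≥0∞) :
    u ∈ X.coh ↔ ∀ v ∈ orth X.coh, pairing v u ≤ 1 := by
  constructor
  · intro hu v hv
    rw [pairing_comm]; exact hv.2 u hu
  · intro h
    rw [← X.biorth]
    refine ⟨fun a => ?_, h⟩
    obtain ⟨v, hv, h0⟩ := X.orth_cover a
    exact ne_top_of_le_ne_top (ENNReal.inv_ne_top.2 h0.ne') (le_inv_of_pairing (h v hv) a)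

theorem PCS.zero_mem (X : PCS) : (fun _ => 0) ∈ X.coh := by
  rw [X.mem_coh_iff]; intro v _; simp [pairing]

theorem PCS.half_mem (X : PCS) {u v : X.Web → ℝ≥0∞} (hu : u ∈ X.coh) (hv : v ∈ X.coh) :
    (fun a => 2⁻¹ * u a + 2⁻¹ * v a) ∈ X.coh := by
  rw [X.mem_coh_iff] at *
  intro w hw
  have : pairing w (fun a => 2⁻¹ * u a + 2⁻¹ * v a) = 2⁻¹ * pairing w u + 2⁻¹ * pairing w v := by
    simp only [pairing, ← ENNReal.tsum_mul_left, ← ENNReal.tsum_add]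
    exact tsum_congr fun a => by ring
  rw [this]
  calc _ ≤ (2⁻¹ : ℝ≥0∞) * 1 + 2⁻¹ * 1 := by gcongr <;> [exact hu w hw; exact hv w hw]
    _ = 1 := by simp [ENNReal.inv_two_add_inv_two]

theorem PCS.iSup_mem (X : PCS) {u : ℕ → X.Web → ℝ≥0∞} (hm : Monotone u) (h : ∀ n, u n ∈ X.coh) :
    (fun a => ⨆ n, u n a) ∈ X.coh := by
  rw [X.mem_coh_iff]
  intro v hv
  rw [pairing, ENNReal.tsum_eq_iSup_sum]
  refine iSup_le fun s => ?_
  simp only [ENNReal.mul_iSup]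
  rw [ENNReal.finsetSum_iSup_of_monotone]
  · refine iSup_le fun n => (ENNReal.sum_le_tsum s).trans ?_
    exact (X.mem_coh_iff _).1 (h n) v hv
  · intro a i j hij
    exact mul_le_mul_right (hm hij a) _

/-! ### Matrices -/

/-- Matrices with rows indexed by `A` and columns indexed by `B`. -/
abbrev Mat (A B : Type) : Type := A × B → ℝ≥0∞

namespace Mat
variable {A B C A' B' : Type}

/-- Application of a matrix to a vector. -/
def app (t : Mat A B) (u : A → ℝ≥0∞) : B → ℝ≥0∞ := fun b => ∑' a, t (a, b) * u a

/-- Composition: first `s`, then `t`. -/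
def comp (t : Mat B C) (s : Mat A B) : Mat A C := fun p => ∑' b, s (p.1, b) * t (b, p.2)

/-- The identity matrix. -/
def one (A : Type) : Mat A A := fun p => kron p.1 p.2

/-- The tensor product of two matrices. -/
def tens (s : Mat A B) (t : Mat A' B') : Mat (A × A') (B × B') :=
  fun p => s (p.1.1, p.2.1) * t (p.1.2, p.2.2)

end Mat

/-- The tensor product of two vectors. -/
def vtens {A B : Type} (u : A → ℝ≥0∞) (v : B → ℝ≥0∞) : A × B → ℝ≥0∞ := fun p => u p.1 * v p.2

namespace Mat
variable {A B C A' B' : Type}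

theorem app_comp (t : Mat B C) (s : Mat A B) (u : A → ℝ≥0∞) :
    (t.comp s).app u = t.app (s.app u) := by
  funext c
  simp only [app, comp, ← ENNReal.tsum_mul_right, ← ENNReal.tsum_mul_left]
  rw [ENNReal.tsum_comm]
  exact tsum_congr fun a => tsum_congr fun b => by ring

theorem app_one (u : A → ℝ≥0∞) : (one A).app u = u := by
  funext b; exact tsum_kron b u

theorem app_tens (s : Mat A B) (t : Mat A' B') (u : A → ℝ≥0∞) (v : A' → ℝ≥0∞) :
    (s.tens t).app (vtens u v) = vtens (s.app u) (t.app v) := by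
  funext p
  simp only [app, tens, vtens]
  rw [ENNReal.tsum_prod', ← ENNReal.tsum_mul_right]
  refine tsum_congr fun a => ?_
  rw [← ENNReal.tsum_mul_left]
  exact tsum_congr fun b => by ring

theorem pairing_vtens (t : Mat A B) (u : A → ℝ≥0∞) (v : B → ℝ≥0∞) :
    pairing (vtens u v) t = pairing v (t.app u) := by
  simp only [pairing, vtens, app, ENNReal.tsum_prod', ← ENNReal.tsum_mul_left]
  rw [ENNReal.tsum_comm]
  exact tsum_congr fun a => tsum_congr fun b => by ring

end Mat

/-! ### Constructions on probabilistic coherence spaces -/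

/-- The space `X ⊸ Y` of linear morphisms. -/
abbrev limpl (X Y : PCS) : PCS :=
  haveI := X.countable_web
  haveI := Y.countable_web
  PCS.ofOrth (A := X.Web × Y.Web) inferInstance
    (orth {w | ∃ u ∈ X.coh, ∃ v ∈ orth Y.coh, w = vtens u v})
    {w | ∃ u ∈ X.coh, ∃ v ∈ orth Y.coh, w = vtens u v} rfl
    (by
      rintro ⟨a, b⟩
      obtain ⟨c, hc0, hc⟩ := X.bounded a
      obtain ⟨d, hd0, hd⟩ := Y.orth_bounded b
      refine ⟨c * d, mul_pos hc0 hd0, ?_⟩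
      rintro _ ⟨u, hu, v, hv, rfl⟩
      rw [ENNReal.coe_mul]
      exact mul_le_mul' (hc u hu) (hd v hv))
    (by
      rintro ⟨a, b⟩
      obtain ⟨u, hu, hu0⟩ := X.cover a
      obtain ⟨v, hv, hv0⟩ := Y.orth_cover b
      exact ⟨_, ⟨u, hu, v, hv, rfl⟩, ENNReal.mul_pos hu0.ne' hv0.ne'⟩)

/-- Morphisms of probabilistic coherence spaces. -/
abbrev Hom (X Y : PCS) : Type := {t : Mat X.Web Y.Web // ∀ u ∈ X.coh, t.app u ∈ Y.coh}

theorem mem_limpl {X Y : PCS} (t : Mat X.Web Y.Web) :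
    t ∈ (limpl X Y).coh ↔ ∀ u ∈ X.coh, t.app u ∈ Y.coh := by
  rw [PCS.mem_coh_iff]
  constructor
  · intro h u hu
    rw [PCS.mem_coh_iff]
    intro v hv
    rw [← Mat.pairing_vtens]
    refine h _ ⟨fun p => ENNReal.mul_ne_top (X.ne_top hu _) (hv.1 _), fun s hs => ?_⟩
    rw [pairing_comm]
    exact hs.2 _ ⟨u, hu, v, hv, rfl⟩
  · intro h v hv
    rw [pairing_comm]
    refine hv.2 t ?_
    refine ⟨fun p => ?_, ?_⟩
    · obtain ⟨u, hu, hu0⟩ := X.cover p.1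
      have h1 := Y.ne_top (h u hu) p.2
      have h2 : t (p.1, p.2) * u p.1 ≤ t.app u p.2 := ENNReal.le_tsum p.1
      intro htop
      apply h1
      rw [← top_le_iff]
      refine le_trans ?_ h2
      rw [show t (p.1, p.2) = ∞ from htop, ENNReal.top_mul hu0.ne']
    · rintro _ ⟨u, hu, w, hw, rfl⟩
      rw [Mat.pairing_vtens]
      exact (Y.mem_coh_iff _).1 (h u hu) w hw

/-- The promotion `u^!` of a vector: `u^! μ = ∏ a, u a ^ μ(a)`. -/
def prom {A : Type} (u : A → ℝ≥0∞) : Multiset A → ℝ≥0∞ := fun μ => (μ.map u).prod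

theorem prom_pos (X : PCS) (μ : Multiset X.Web) : ∃ u ∈ X.coh, ∀ a ∈ μ, 0 < u a := by
  induction μ using Multiset.induction_on with
  | empty => exact ⟨_, X.zero_mem, by simp⟩
  | cons a μ ih =>
    obtain ⟨u, hu, h⟩ := ih
    obtain ⟨v, hv, h'⟩ := X.cover a
    refine ⟨_, X.half_mem hu hv, fun b hb => ?_⟩
    rcases Multiset.mem_cons.1 hb with rfl | hb
    · exact lt_of_lt_of_le (ENNReal.mul_pos (by simp) h'.ne') le_add_self
    · exact lt_of_lt_of_le (ENNReal.mul_pos (by simp) (h b hb).ne') le_self_add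

theorem prom_bounded (X : PCS) (μ : Multiset X.Web) :
    ∃ c : ℝ≥0, 0 < c ∧ ∀ u ∈ X.coh, prom u μ ≤ c := by
  induction μ using Multiset.induction_on with
  | empty => exact ⟨1, one_pos, by simp [prom]⟩
  | cons a μ ih =>
    obtain ⟨c, hc0, hc⟩ := ih
    obtain ⟨d, hd0, hd⟩ := X.bounded a
    refine ⟨d * c, mul_pos hd0 hc0, fun u hu => ?_⟩
    have : prom u (a ::ₘ μ) = u a * prom u μ := by simp [prom]
    rw [this, ENNReal.coe_mul]
    exact mul_le_mul' (hd u hu) (hc u hu)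

theorem prom_gen_cover (X : PCS) (μ : Multiset X.Web) :
    ∃ s ∈ {U | ∃ u ∈ X.coh, U = prom u}, 0 < s μ := by
  obtain ⟨u, hu, h⟩ := prom_pos X μ
  refine ⟨_, ⟨u, hu, rfl⟩, pos_iff_ne_zero.2 ?_⟩
  intro h0
  have := Multiset.prod_eq_zero_iff.1 h0
  obtain ⟨a, ha, ha0⟩ := Multiset.mem_map.1 this
  exact (h a ha).ne' ha0

/-- The exponential `!X`. -/
abbrev excl (X : PCS) : PCS :=
  haveI := X.countable_web
  PCS.ofOrth (A := Multiset X.Web) inferInstance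
    (orth (orth {U | ∃ u ∈ X.coh, U = prom u})) (orth {U | ∃ u ∈ X.coh, U = prom u}) rfl
    (by
      intro μ
      obtain ⟨s, ⟨u, hu, rfl⟩, h⟩ := prom_gen_cover X μ
      have hne : prom u μ ≠ ∞ := by
        obtain ⟨c, -, hc⟩ := prom_bounded X μ
        exact ne_top_of_le_ne_top ENNReal.coe_ne_top (hc u hu)
      refine ⟨(prom u μ)⁻¹.toNNReal,
        ENNReal.toNNReal_pos (ENNReal.inv_ne_zero.2 hne) (ENNReal.inv_ne_top.2 h.ne'), ?_⟩
      intro v hv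
      rw [ENNReal.coe_toNNReal (ENNReal.inv_ne_top.2 h.ne')]
      exact le_inv_of_pairing (hv.2 _ ⟨u, hu, rfl⟩) μ)
    (by
      intro μ
      obtain ⟨c, hc0, hc⟩ := prom_bounded X μ
      refine ⟨_, scaled_kron_mem_orth μ (c := c) (by simpa using hc0.ne') ?_, ?_⟩
      · rintro _ ⟨u, hu, rfl⟩
        exact hc u hu
      · simp [kron_self])

theorem prom_mem {X : PCS} {u : X.Web → ℝ≥0∞} (hu : u ∈ X.coh) : prom u ∈ (excl X).coh := by
  rw [PCS.mem_coh_iff]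
  intro v hv
  rw [pairing_comm]
  refine hv.2 _ ⟨fun μ => ?_, fun w hw => ?_⟩
  · obtain ⟨c, -, hc⟩ := prom_bounded X μ
    exact ne_top_of_le_ne_top ENNReal.coe_ne_top (hc u hu)
  · rw [pairing_comm]; exact hw.2 _ ⟨u, hu, rfl⟩

/-- The binary cartesian product `X & Y`. -/
abbrev prod (X Y : PCS) : PCS :=
  haveI := X.countable_web
  haveI := Y.countable_web
  PCS.ofOrth (A := X.Web ⊕ Y.Web) inferInstance
    {u | (fun a => u (Sum.inl a)) ∈ X.coh ∧ (fun b => u (Sum.inr b)) ∈ Y.coh}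
    ({w | ∃ v ∈ orth X.coh, w = Sum.elim v (fun _ => 0)} ∪
      {w | ∃ v ∈ orth Y.coh, w = Sum.elim (fun _ => 0) v})
    (by
      ext u
      constructor
      · rintro ⟨h1, h2⟩
        refine ⟨?_, ?_⟩
        · rintro (a | b)
          · exact X.ne_top h1 a
          · exact Y.ne_top h2 b
        · rintro _ (⟨v, hv, rfl⟩ | ⟨v, hv, rfl⟩)
          · simpa [pairing, Summable.tsum_sum ENNReal.summable ENNReal.summable] using (X.mem_coh_iff _).1 h1 v hv
          · simpa [pairing, Summable.tsum_sum ENNReal.summable ENNReal.summable] using (Y.mem_coh_iff _).1 h2 v hv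
      · rintro ⟨-, h⟩
        refine ⟨(X.mem_coh_iff _).2 fun v hv => ?_, (Y.mem_coh_iff _).2 fun v hv => ?_⟩
        · simpa [pairing, Summable.tsum_sum ENNReal.summable ENNReal.summable] using h _ (Or.inl ⟨v, hv, rfl⟩)
        · simpa [pairing, Summable.tsum_sum ENNReal.summable ENNReal.summable] using h _ (Or.inr ⟨v, hv, rfl⟩))
    (by
      rintro (a | b)
      · obtain ⟨c, hc0, hc⟩ := X.orth_bounded a
        refine ⟨c, hc0, ?_⟩
        rintro _ (⟨v, hv, rfl⟩ | ⟨v, hv, rfl⟩)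
        · exact hc v hv
        · simp
      · obtain ⟨c, hc0, hc⟩ := Y.orth_bounded b
        refine ⟨c, hc0, ?_⟩
        rintro _ (⟨v, hv, rfl⟩ | ⟨v, hv, rfl⟩)
        · simp
        · exact hc v hv)
    (by
      rintro (a | b)
      · obtain ⟨v, hv, h⟩ := X.orth_cover a
        exact ⟨_, Or.inl ⟨v, hv, rfl⟩, h⟩
      · obtain ⟨v, hv, h⟩ := Y.orth_cover b
        exact ⟨_, Or.inr ⟨v, hv, rfl⟩, h⟩)

/-- The terminal object, with an empty web. -/
abbrev top : PCS :=
  PCS.ofOrth (A := Empty) inferInstance Set.univ ∅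
    (by ext u; simp [orth]) (fun a => a.elim) (fun a => a.elim)

/-- The space of natural numbers: its elements are the sub-probability distributions on `ℕ`. -/
abbrev natPCS : PCS :=
  PCS.ofOrth (A := ℕ) inferInstance {u | ∑' n, u n ≤ 1} {fun _ => 1}
    (by
      ext u
      constructor
      · intro h
        refine ⟨fun a => ne_top_of_le_ne_top ENNReal.one_ne_top ((ENNReal.le_tsum a).trans h), ?_⟩
        rintro _ rfl
        simpa [pairing] using h
      · intro h
        simpa [pairing] using h.2 _ rfl)
    (fun _ => ⟨1, one_pos, by simp⟩)
    (fun _ => ⟨_, rfl, by simp⟩)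


/-! ### Exponential structure -/

namespace Mat
variable {A B C A' B' Z : Type}

open Classical in
/-- The factorial of a finite multiset: the product of the factorials of its multiplicities. -/
def mfact (μ : Multiset A) : ℕ := ∏ a ∈ μ.toFinset, (μ.count a).factorial

/-- The multisets of pairs with marginals `μ` and `ν`. -/
def coupling (μ : Multiset A) (ν : Multiset B) : Set (Multiset (A × B)) :=
  {ρ | ρ.map Prod.fst = μ ∧ ρ.map Prod.snd = ν}

/-- The functorial action `!t` of the exponential. -/
def bang (t : Mat A B) : Mat (Multiset A) (Multiset B) := fun p =>
  ∑' ρ : coupling p.1 p.2, ((mfact p.2 : ℝ≥0∞) / (mfact ρ.1 : ℝ≥0∞)) * (ρ.1.map t).prod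

/-- Dereliction. -/
def der (A : Type) : Mat (Multiset A) A := fun p => kron {p.2} p.1

/-- Digging. -/
def dig (A : Type) : Mat (Multiset A) (Multiset (Multiset A)) := fun p => kron p.2.sum p.1

/-- Weakening, valued in the tensor unit (whose web has one element). -/
def weak (A : Type) : Mat (Multiset A) Unit := fun p => kron 0 p.1

/-- Contraction. -/
def contr (A : Type) : Mat (Multiset A) (Multiset A × Multiset A) :=
  fun p => kron (p.2.1 + p.2.2) p.1

/-- The isomorphism `!X ⊗ !Y ≅ !(X & Y)`. -/
def seely (A B : Type) : Mat (Multiset A × Multiset B) (Multiset (A ⊕ B)) :=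
  fun p => kron (p.1.1.map Sum.inl + p.1.2.map Sum.inr) p.2

/-- Promotion of a Kleisli morphism: digging followed by the functorial action. -/
def promo (f : Mat (Multiset A) B) : Mat (Multiset A) (Multiset B) := (bang f).comp (dig A)

/-- Linear evaluation `(X ⊸ Y) ⊗ X → Y`. -/
def evlin (A B : Type) : Mat ((A × B) × A) B := fun p => kron p.1.1 (p.1.2, p.2)

/-- Linear currying. -/
def curlin (t : Mat (C × A) B) : Mat C (A × B) := fun p => t ((p.1, p.2.1), p.2.2)

/-- The Kleisli morphism `Ev ∘ ⟨f, g⟩`. -/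
def kapp (f : Mat (Multiset Z) (Multiset A × B)) (g : Mat (Multiset Z) A) : Mat (Multiset Z) B :=
  (evlin (Multiset A) B).comp ((f.tens (promo g)).comp (contr Z))

/-- Currying in the Kleisli category. -/
def cur (f : Mat (Multiset (Z ⊕ A)) B) : Mat (Multiset Z) (Multiset A × B) :=
  curlin (f.comp (seely Z A))

/-- The approximants of the least fix-point operator: `0`, then `Ev ∘ ⟨id, -⟩` repeatedly. -/
def sfixN (A : Type) : ℕ → Mat (Multiset (Multiset A × A)) A
  | 0 => fun _ => 0
  | n + 1 => kapp (der (Multiset A × A)) (sfixN A n)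

/-- The least fix-point operator, as a Kleisli morphism from `X ⇒ X` to `X`. -/
def sfix (A : Type) : Mat (Multiset (Multiset A × A)) A := fun p => ⨆ n, sfixN A n p

open Classical in
/-- The coalgebra structure `N → !N` of the natural numbers. -/
def natalg : Mat ℕ (Multiset ℕ) := fun p => if ∃ k : ℕ, p.2 = k • {p.1} then 1 else 0

/-- The successor. -/
def ssuc : Mat ℕ ℕ := fun p => kron (p.1 + 1) p.2

/-- The zero branch of the conditional. -/
def sif0 (A : Type) : Mat (Multiset A × Multiset (Multiset ℕ × A)) A :=
  fun p => der A (p.1.1, p.2) * weak (Multiset ℕ × A) (p.1.2, ())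

/-- The linear evaluation `!N ⊗ (!N ⊸ X) → X` preceded by `natalg ⊗ weakening ⊗ dereliction`:
the successor branch of the conditional. -/
def sifS (A : Type) : Mat (ℕ × (Multiset A × Multiset (Multiset ℕ × A))) A :=
  Mat.comp (B := Multiset ℕ × (Unit × (Multiset ℕ × A)))
    (fun p => evlin (Multiset ℕ) A ((p.1.2.2, p.1.1), p.2))
    (natalg.tens ((weak A).tens (der (Multiset ℕ × A))))

/-- The conditional morphism `N ⊗ !X ⊗ !(!N ⊸ X) → X`. -/
def sif (A : Type) : Mat (ℕ × (Multiset A × Multiset (Multiset ℕ × A))) A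
  | ((0, q), a) => sif0 A (q, a)
  | ((n + 1, q), a) => sifS A ((n, q), a)

/-- A constant Kleisli morphism. -/
def const (v : B → ℝ≥0∞) : Mat (Multiset Z) B := fun p => weak Z (p.1, ()) * v p.2

/-! Action of these matrices on promoted vectors. -/

theorem prom_zero (u : A → ℝ≥0∞) : prom u 0 = 1 := by simp [prom]
theorem prom_add (u : A → ℝ≥0∞) (μ ν : Multiset A) : prom u (μ + ν) = prom u μ * prom u ν := by
  simp [prom]
theorem prom_singleton (u : A → ℝ≥0∞) (a : A) : prom u {a} = u a := by simp [prom]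
theorem prom_sum (u : A → ℝ≥0∞) (m : Multiset (Multiset A)) : prom u m.sum = prom (prom u) m := by
  induction m using Multiset.induction_on with
  | empty => simp [prom]
  | cons a m ih =>
    rw [Multiset.sum_cons, prom_add, ih]; simp [prom]

theorem app_der (u : A → ℝ≥0∞) : (der A).app (prom u) = u := by
  funext a
  simp only [app, der]
  rw [tsum_kron' {a} (prom u), prom_singleton]

theorem app_dig (u : A → ℝ≥0∞) : (dig A).app (prom u) = prom (prom u) := by
  funext m
  simp only [app, dig]
  rw [tsum_kron' m.sum (prom u), prom_sum]

theorem app_weak (u : A → ℝ≥0∞) : (weak A).app (prom u) = fun _ => 1 := by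
  funext m
  simp only [app, weak]
  rw [tsum_kron' 0 (prom u), prom_zero]

theorem app_contr (u : A → ℝ≥0∞) : (contr A).app (prom u) = vtens (prom u) (prom u) := by
  funext p
  simp only [app, contr]
  rw [tsum_kron' (p.1 + p.2) (prom u), prom_add]; rfl

theorem app_const (v : B → ℝ≥0∞) (u : Z → ℝ≥0∞) : (const v).app (prom u) = v := by
  funext b
  have := congrFun (app_weak u) ()
  simp only [app] at this
  simp only [app, const]
  calc _ = ∑' m, (weak Z (m, ()) * prom u m) * v b := tsum_congr fun m => by ring
    _ = v b := by rw [ENNReal.tsum_mul_right, this, one_mul]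

theorem app_seely (u : A → ℝ≥0∞) (v : B → ℝ≥0∞) :
    (seely A B).app (vtens (prom u) (prom v)) = prom (Sum.elim u v) := by
  classical
  funext m
  simp only [app, seely]
  have key : ∀ m : Multiset (A ⊕ B), ∃ p : Multiset A × Multiset B,
      m = p.1.map Sum.inl + p.2.map Sum.inr := by
    intro m
    induction m using Multiset.induction_on with
    | empty => exact ⟨(0, 0), by simp⟩
    | cons a m ih =>
      obtain ⟨p, hp⟩ := ih
      rcases a with a | b
      · exact ⟨(a ::ₘ p.1, p.2), by simp [hp]⟩
      · exact ⟨(p.1, b ::ₘ p.2), by simp [hp]⟩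
  have inj : ∀ p q : Multiset A × Multiset B,
      p.1.map (Sum.inl : A → A ⊕ B) + p.2.map Sum.inr = q.1.map Sum.inl + q.2.map Sum.inr →
      p = q := by
    intro p q h
    have h1 := congrArg (Multiset.filterMap Sum.getLeft?) h
    have h2 := congrArg (Multiset.filterMap Sum.getRight?) h
    simp only [Multiset.filterMap_add, Multiset.filterMap_map] at h1 h2
    have e1 : ((Sum.getLeft? : A ⊕ B → Option A) ∘ Sum.inl) = some := rfl
    have e2 : ((Sum.getLeft? : A ⊕ B → Option A) ∘ Sum.inr) = fun _ => none := rfl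
    have e3 : ((Sum.getRight? : A ⊕ B → Option B) ∘ Sum.inl) = fun _ => none := rfl
    have e4 : ((Sum.getRight? : A ⊕ B → Option B) ∘ Sum.inr) = some := rfl
    have n1 : ∀ (s : Multiset B), Multiset.filterMap (fun _ => (none : Option A)) s = 0 := by
      intro s; induction s using Multiset.induction_on <;> simp_all
    have n2 : ∀ (s : Multiset A), Multiset.filterMap (fun _ => (none : Option B)) s = 0 := by
      intro s; induction s using Multiset.induction_on <;> simp_all
    rw [e1, e2, n1, n1] at h1
    rw [e3, e4, n2, n2] at h2
    simp only [Multiset.filterMap_some, add_zero, zero_add] at h1 h2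
    exact Prod.ext h1 h2
  obtain ⟨p, rfl⟩ := key m
  rw [tsum_eq_single p]
  · rw [kron_self, one_mul]
    simp [prom, vtens]
  · intro q hq
    rw [kron, if_neg (fun h => hq (inj _ _ h)), zero_mul]

theorem mfact_zero : mfact (0 : Multiset A) = 1 := by simp [mfact]

theorem mfact_cons [inst : DecidableEq A] (a : A) (μ : Multiset A) :
    mfact (a ::ₘ μ) = (μ.count a + 1) * mfact μ := by
  obtain rfl : inst = Classical.decEq A := Subsingleton.elim _ _
  let _ := Classical.decEq A
  have h1 : mfact μ = ∏ x ∈ (a ::ₘ μ).toFinset, (μ.count x).factorial := by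
    refine Finset.prod_subset (by intro x; simp +contextual) ?_
    intro x _ hx
    rw [Multiset.count_eq_zero_of_notMem (by simpa using hx)]; rfl
  have ha : a ∈ (a ::ₘ μ).toFinset := by simp
  rw [h1, mfact, ← Finset.mul_prod_erase _ _ ha, ← Finset.mul_prod_erase _ (fun x => (μ.count x).factorial) ha,
    ← mul_assoc, Multiset.count_cons_self, Nat.factorial_succ]
  congr 1
  refine Finset.prod_congr rfl fun x hx => ?_
  rw [Multiset.count_cons_of_ne (Finset.ne_of_mem_erase hx)]

theorem mfact_ne_zero (μ : Multiset A) : mfact μ ≠ 0 :=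
  Finset.prod_ne_zero_iff.2 fun _ _ => Nat.factorial_ne_zero _

open Classical in
theorem tsum_count (b : B) (ρ : Multiset (A × B)) :
    ∑' a, (ρ.count (a, b) : ℝ≥0∞) = ((ρ.map Prod.snd).count b : ℝ≥0∞) := by
  induction ρ using Multiset.induction_on with
  | empty => simp
  | cons p ρ ih =>
    obtain ⟨a', b'⟩ := p
    simp only [Multiset.count_cons, Multiset.map_cons, Nat.cast_add, ENNReal.tsum_add, ih]
    congr 1
    by_cases hb : b = b'
    · subst hb
      rw [tsum_eq_single a']
      · simp
      · intro x hx; simp [hx]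
    · simp [hb]

open Classical in
theorem tsum_coupling (w : A × B → ℝ≥0∞) (ν : Multiset B) :
    ∑' ρ : Multiset (A × B), (if ρ.map Prod.snd = ν then
      ((mfact ν : ℝ≥0∞) / (mfact ρ : ℝ≥0∞)) * (ρ.map w).prod else 0) =
    (ν.map fun b => ∑' a, w (a, b)).prod := by
  induction ν using Multiset.induction_on with
  | empty =>
    rw [tsum_eq_single 0]
    · simp [mfact_zero]
    · intro ρ hρ; simp [hρ]
  | cons b ν ih =>
    rw [Multiset.map_cons, Multiset.prod_cons, ← ih, ← ENNReal.tsum_mul_right]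
    have step : ∀ a, w (a, b) * (∑' ρ : Multiset (A × B), (if ρ.map Prod.snd = ν then
        ((mfact ν : ℝ≥0∞) / (mfact ρ : ℝ≥0∞)) * (ρ.map w).prod else 0)) =
        ∑' ρ : Multiset (A × B), if (a, b) ∈ ρ ∧ ρ.map Prod.snd = b ::ₘ ν then
          ((mfact ν : ℝ≥0∞) * ρ.count (a, b) / mfact ρ) * (ρ.map w).prod else 0 := by
      intro a
      rw [← ENNReal.tsum_mul_left]
      have hinj : Function.Injective (fun ρ : Multiset (A × B) => (a, b) ::ₘ ρ) :=
        fun x y h => (Multiset.cons_inj_right _).1 h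
      rw [← hinj.tsum_eq (f := fun ρ : Multiset (A × B) =>
        if (a, b) ∈ ρ ∧ ρ.map Prod.snd = b ::ₘ ν then
          ((mfact ν : ℝ≥0∞) * ρ.count (a, b) / mfact ρ) * (ρ.map w).prod else 0)]
      · refine tsum_congr fun ρ => ?_
        simp only [Multiset.mem_cons_self, Multiset.map_cons, Multiset.cons_inj_right, true_and,
          Multiset.prod_cons, Multiset.count_cons_self, mfact_cons]
        split_ifs
        · have h1 : ((ρ.count (a, b) + 1 : ℕ) : ℝ≥0∞) ≠ 0 := by simp
          have h2 : ((ρ.count (a, b) + 1 : ℕ) : ℝ≥0∞) ≠ ∞ := ENNReal.natCast_ne_top _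
          rw [Nat.cast_mul, mul_comm (mfact ν : ℝ≥0∞), ENNReal.mul_div_mul_left _ _ h1 h2]
          ring
        · simp
      · intro ρ hρ
        simp only [Function.mem_support, ne_eq, ite_eq_right_iff, not_forall] at hρ
        obtain ⟨⟨h, -⟩, -⟩ := hρ
        exact ⟨ρ.erase (a, b), Multiset.cons_erase h⟩
    simp only [step]
    rw [ENNReal.tsum_comm]
    refine tsum_congr fun ρ => ?_
    by_cases hρ : ρ.map Prod.snd = b ::ₘ ν
    · simp only [hρ, if_true, and_true]
      have : ∀ a, (if (a, b) ∈ ρ then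
          ((mfact ν : ℝ≥0∞) * ρ.count (a, b) / mfact ρ) * (ρ.map w).prod else 0) =
          (ρ.count (a, b) : ℝ≥0∞) * ((mfact ν : ℝ≥0∞) / mfact ρ * (ρ.map w).prod) := by
        intro a
        split_ifs with h
        · simp only [div_eq_mul_inv]; ring
        · simp [Multiset.count_eq_zero_of_notMem h]
      simp only [this]
      rw [ENNReal.tsum_mul_right, tsum_count, hρ, Multiset.count_cons_self, mfact_cons, Nat.cast_mul]
      simp only [div_eq_mul_inv]; ring
    · simp [hρ]

theorem app_bang (t : Mat A B) (u : A → ℝ≥0∞) : (bang t).app (prom u) = prom (t.app u) := by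
  classical
  funext ν
  simp only [app, prom]
  have e := tsum_coupling (fun p => t p * u p.1) ν
  change _ = (ν.map (t.app u)).prod at e
  rw [← e]
  have h : ∀ μ : Multiset A, bang t (μ, ν) * (μ.map u).prod = ∑' ρ : Multiset (A × B),
      if ρ.map Prod.fst = μ then (if ρ.map Prod.snd = ν then ((mfact ν : ℝ≥0∞) / (mfact ρ : ℝ≥0∞)) *
        (ρ.map fun p => t p * u p.1).prod else 0) else 0 := by
    intro μ
    simp only [bang]
    rw [tsum_subtype (coupling μ ν) (fun ρ => ((mfact ν : ℝ≥0∞) / (mfact ρ : ℝ≥0∞)) *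
      (ρ.map t).prod), ← ENNReal.tsum_mul_right]
    refine tsum_congr fun ρ => ?_
    by_cases h1 : ρ.map Prod.fst = μ
    · by_cases h2 : ρ.map Prod.snd = ν
      · rw [Set.indicator_of_mem (show ρ ∈ coupling μ ν from ⟨h1, h2⟩), if_pos h1, if_pos h2,
          Multiset.prod_map_mul, ← h1, Multiset.map_map]
        simp only [Function.comp_def]; ring
      · rw [Set.indicator_of_notMem (fun h => h2 h.2), if_pos h1, if_neg h2, zero_mul]
    · rw [Set.indicator_of_notMem (fun h => h1 h.1), if_neg h1, zero_mul]
  simp only [h]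
  rw [ENNReal.tsum_comm]
  refine tsum_congr fun ρ => ?_
  rw [tsum_eq_single (ρ.map Prod.fst)]
  · simp
  · intro μ hμ; simp [hμ.symm]

theorem app_promo (f : Mat (Multiset A) B) (u : A → ℝ≥0∞) :
    (promo f).app (prom u) = prom (f.app (prom u)) := by
  rw [promo, app_comp, app_dig, app_bang]

theorem app_evlin (t : Mat A B) (u : A → ℝ≥0∞) : (evlin A B).app (vtens t u) = t.app u := by
  funext b
  simp only [app, evlin, vtens]
  rw [ENNReal.tsum_prod', ENNReal.tsum_comm]
  refine tsum_congr fun a => ?_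
  rw [tsum_kron (a, b) (fun p => t p * u a)]

theorem app_kapp (f : Mat (Multiset Z) (Multiset A × B)) (g : Mat (Multiset Z) A) (u : Z → ℝ≥0∞) :
    (kapp f g).app (prom u) = Mat.app (f.app (prom u)) (prom (g.app (prom u))) := by
  rw [kapp, app_comp, app_comp, app_contr, app_tens, app_promo, app_evlin]

theorem app_curlin (t : Mat (C × A) B) (u : C → ℝ≥0∞) (v : A → ℝ≥0∞) :
    Mat.app ((curlin t).app u) v = t.app (vtens u v) := by
  funext b
  simp only [app, curlin, vtens]
  rw [ENNReal.tsum_prod', ENNReal.tsum_comm]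
  refine tsum_congr fun a => ?_
  rw [← ENNReal.tsum_mul_right]
  exact tsum_congr fun c => by ring

theorem app_cur (f : Mat (Multiset (Z ⊕ A)) B) (u : Z → ℝ≥0∞) (v : A → ℝ≥0∞) :
    Mat.app ((cur f).app (prom u)) (prom v) = f.app (prom (Sum.elim u v)) := by
  rw [cur, app_curlin, app_comp, app_seely]

theorem app_sif (x : ℕ → ℝ≥0∞) (q : A → ℝ≥0∞) (r : Mat (Multiset ℕ) A) (a : A) :
    (sif A).app (vtens x (vtens (prom q) (prom r))) a =
      x 0 * q a + ∑' n, x (n + 1) * r.app (prom fun k => kron n k) a := by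
  have h0 : (sif0 A).app (vtens (prom q) (prom r)) a = q a := by
    have h1 := congrFun (app_der q) a
    have h2 := congrFun (app_weak r) ()
    simp only [app] at h1 h2
    simp only [app, sif0, vtens, ENNReal.tsum_prod']
    rw [← mul_one (q a), ← h1, ← h2, ← ENNReal.tsum_mul_right]
    refine tsum_congr fun m => ?_
    rw [← ENNReal.tsum_mul_left]
    exact tsum_congr fun m' => by ring
  have hnat : ∀ n m, natalg (n, m) = prom (fun k => kron n k) m := by
    intro n m
    simp only [natalg, prom]
    induction m using Multiset.induction_on with
    | empty => simp; exact ⟨0, by simp⟩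
    | cons k m ih =>
      rw [Multiset.map_cons, Multiset.prod_cons, ← ih]
      by_cases hk : n = k
      · subst hk
        rw [kron_self, one_mul]
        congr 1
        refine propext ⟨?_, ?_⟩
        · rintro ⟨j, hj⟩
          rcases j with _ | j
          · simp at hj
          · refine ⟨j, ?_⟩
            rw [succ_nsmul, add_comm, Multiset.singleton_add] at hj
            exact (Multiset.cons_inj_right _).1 hj
        · rintro ⟨j, hj⟩
          exact ⟨j + 1, by rw [succ_nsmul, add_comm, Multiset.singleton_add, hj]⟩
      · rw [kron, if_neg hk, zero_mul, if_neg]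
        rintro ⟨j, hj⟩
        have : k ∈ j • ({n} : Multiset ℕ) := hj ▸ Multiset.mem_cons_self k m
        have := Multiset.mem_of_mem_nsmul this
        exact hk (Multiset.mem_singleton.1 this).symm
  have hS : ∀ y : ℕ → ℝ≥0∞, (sifS A).app (vtens y (vtens (prom q) (prom r))) a =
      ∑' n, y n * r.app (prom fun k => kron n k) a := by
    intro y
    rw [sifS, app_comp, app_tens, app_tens, app_weak, app_der]
    have h1 : ∀ m : Multiset ℕ, ∑' p : Unit × (Multiset ℕ × A),
        evlin (Multiset ℕ) A ((p.2, m), a) * (natalg.app y m * (1 * r p.2)) =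
        natalg.app y m * r (m, a) := by
      intro m
      rw [ENNReal.tsum_prod', tsum_fintype]
      simp only [Finset.univ_unique, Finset.sum_singleton, evlin, one_mul]
      exact tsum_kron (m, a) fun p => natalg.app y m * r p
    simp only [app] at h1
    simp only [app, vtens]
    rw [ENNReal.tsum_prod']
    rw [tsum_congr h1]
    simp only [← ENNReal.tsum_mul_right, ← ENNReal.tsum_mul_left, hnat]
    rw [ENNReal.tsum_comm]
    exact tsum_congr fun n => tsum_congr fun m => by ring
  rw [← h0, ← hS]
  simp only [app]
  rw [ENNReal.tsum_prod', tsum_eq_zero_add' ENNReal.summable]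
  congr 1
  · rw [← ENNReal.tsum_mul_left]
    exact tsum_congr fun p => by simp only [sif, vtens]; ring
  · rw [ENNReal.tsum_prod']
    rfl

end Mat


/-! ### Linear morphisms and the Kleisli category -/

/-- Composition of morphisms: first `f`, then `g`. -/
def Hom.comp {X Y Z : PCS} (g : Hom Y Z) (f : Hom X Y) : Hom X Z :=
  ⟨Mat.comp g.1 f.1, fun u hu => by rw [Mat.app_comp]; exact g.2 _ (f.2 u hu)⟩

/-- Morphisms of the Kleisli category of the exponential comonad. -/
abbrev Kl (X Y : PCS) : Type := Hom (excl X) Y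

/-- The internal hom `X ⇒ Y` of the Kleisli category. -/
abbrev impl (X Y : PCS) : PCS := limpl (excl X) Y

/-- A matrix is a Kleisli morphism as soon as it acts well on promoted vectors. -/
theorem kl_of_prom {X Y : PCS} (t : Mat (excl X).Web Y.Web)
    (h : ∀ u ∈ X.coh, t.app (prom u) ∈ Y.coh) (U : Multiset X.Web → ℝ≥0∞)
    (hU : U ∈ (excl X).coh) : t.app U ∈ Y.coh := by
  rw [PCS.mem_coh_iff]
  intro v hv
  rw [← Mat.pairing_vtens]
  have hT : (fun μ => ∑' b, t (μ, b) * v b) ∈ orth {U | ∃ u ∈ X.coh, U = prom u} := by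
    have hp : ∀ W : Multiset X.Web → ℝ≥0∞,
        pairing W (fun μ => ∑' b, t (μ, b) * v b) = pairing v (t.app W) := by
      intro W
      simp only [pairing, Mat.app, ← ENNReal.tsum_mul_left]
      rw [ENNReal.tsum_comm]
      exact tsum_congr fun b => tsum_congr fun m => by ring
    have h2 : ∀ W ∈ {U | ∃ u ∈ X.coh, U = prom u},
        pairing W (fun μ => ∑' b, t (μ, b) * v b) ≤ 1 := by
      rintro _ ⟨u, hu, rfl⟩
      rw [hp]
      exact (Y.mem_coh_iff _).1 (h u hu) v hv
    refine ⟨fun μ => ?_, h2⟩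
    obtain ⟨s, hs, hs0⟩ := prom_gen_cover X μ
    exact ne_top_of_le_ne_top (ENNReal.inv_ne_top.2 hs0.ne') (le_inv_of_pairing (h2 s hs) μ)
  have := hU.2 _ hT
  refine le_trans (le_of_eq ?_) this
  simp only [pairing, vtens, ENNReal.tsum_prod', ← ENNReal.tsum_mul_right]
  exact tsum_congr fun m => tsum_congr fun b => by ring

/-- The Kleisli morphism of a matrix acting well on promoted vectors. -/
def Kl.mk' {X Y : PCS} (t : Mat (excl X).Web Y.Web)
    (h : ∀ u ∈ X.coh, t.app (prom u) ∈ Y.coh) : Kl X Y := ⟨t, kl_of_prom t h⟩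

theorem Kl.app_mem {X Y : PCS} (f : Kl X Y) {u : X.Web → ℝ≥0∞} (hu : u ∈ X.coh) :
    f.1.app (prom u) ∈ Y.coh := f.2 _ (prom_mem hu)

namespace Kl
variable {X Y Z : PCS}

/-- The linear morphism `X → Y`, seen as a Kleisli morphism through dereliction. -/
def ofLin (g : Hom X Y) : Kl X Y :=
  mk' (g.1.comp (Mat.der X.Web)) fun u hu => by
    rw [Mat.app_comp, Mat.app_der]; exact g.2 u hu

/-- The identity. -/
def ident (X : PCS) : Kl X X :=
  mk' (Mat.der X.Web) fun u hu => by rw [Mat.app_der]; exact hu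

/-- Composition `g ∘ f`: the matrix composition of `g` with the promotion of `f`. -/
def comp (g : Kl Y Z) (f : Kl X Y) : Kl X Z :=
  mk' (g.1.comp (Mat.promo f.1)) fun u hu => by
    rw [Mat.app_comp, Mat.app_promo]; exact g.app_mem (f.app_mem hu)

/-- The constant morphism. -/
def const (v : Y.Web → ℝ≥0∞) (hv : v ∈ Y.coh) : Kl Z Y :=
  mk' (Mat.const v) fun u _ => by rw [Mat.app_const]; exact hv

/-- Application: `Ev ∘ ⟨f, g⟩`. -/
def app (f : Kl Z (impl X Y)) (g : Kl Z X) : Kl Z Y :=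
  mk' (Mat.kapp f.1 g.1) fun u hu => by
    rw [Mat.app_kapp]
    exact (mem_limpl _).1 (f.app_mem hu) _ (prom_mem (g.app_mem hu))

theorem elim_mem {u : Z.Web → ℝ≥0∞} {v : X.Web → ℝ≥0∞} (hu : u ∈ Z.coh) (hv : v ∈ X.coh) :
    Sum.elim u v ∈ (prod Z X).coh := ⟨hu, hv⟩

/-- Currying. -/
def cur (f : Kl (prod Z X) Y) : Kl Z (impl X Y) :=
  mk' (Mat.cur f.1) fun u hu => (mem_limpl _).2 <| kl_of_prom _ fun v hv => by
    rw [Mat.app_cur]; exact f.app_mem (elim_mem hu hv)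

theorem comp_mono {A B C : Type} {t t' : Mat B C} {s s' : Mat A B} (ht : t ≤ t') (hs : s ≤ s') :
    t.comp s ≤ t'.comp s' :=
  fun _ => ENNReal.tsum_le_tsum fun _ => mul_le_mul' (hs _) (ht _)

theorem promo_mono {A B : Type} {f g : Mat (Multiset A) B} (h : f ≤ g) :
    Mat.promo f ≤ Mat.promo g := by
  refine comp_mono (fun p => ENNReal.tsum_le_tsum fun ρ => ?_) le_rfl
  refine mul_le_mul' le_rfl ?_
  generalize ρ.1 = m
  induction m using Multiset.induction_on with
  | empty => simp
  | cons a m ih =>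
    simp only [Multiset.map_cons, Multiset.prod_cons]
    exact mul_le_mul' (h a) ih

theorem kapp_mono {Z A B : Type} (f : Mat (Multiset Z) (Multiset A × B))
    {g g' : Mat (Multiset Z) A} (h : g ≤ g') : Mat.kapp f g ≤ Mat.kapp f g' :=
  comp_mono le_rfl <| comp_mono (fun _ => mul_le_mul' le_rfl (promo_mono h _)) le_rfl

theorem sfixN_mono (A : Type) : Monotone (Mat.sfixN A) := by
  refine monotone_nat_of_le_succ fun n => ?_
  induction n with
  | zero => exact fun _ => zero_le
  | succ n ih => exact kapp_mono _ ih

theorem sfixN_mem (X : PCS) (n : ℕ) : Mat.sfixN X.Web n ∈ (impl (impl X X) X).coh := by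
  induction n with
  | zero => exact PCS.zero_mem _
  | succ n ih =>
    exact (mem_limpl _).2 (app (ident (impl X X)) ⟨_, (mem_limpl _).1 ih⟩).2

/-- The least fix-point morphism. -/
def sfix (X : PCS) : Kl (impl X X) X :=
  ⟨Mat.sfix X.Web, (mem_limpl _).1 <|
    (impl (impl X X) X).iSup_mem (sfixN_mono X.Web) (sfixN_mem X)⟩

theorem natPCS_succ_mem {u : ℕ → ℝ≥0∞} (hu : u ∈ natPCS.coh) : Mat.ssuc.app u ∈ natPCS.coh := by
  change ∑' m, ∑' n, Mat.ssuc (n, m) * u n ≤ 1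
  rw [ENNReal.tsum_comm]
  simp only [Mat.ssuc, tsum_kron' _ (fun _ => u _)]
  exact hu

/-- The successor, as a linear morphism. -/
def ssuc : Hom natPCS natPCS := ⟨Mat.ssuc, fun _ hu => natPCS_succ_mem hu⟩

theorem kron_mem (n : ℕ) : (fun k => kron n k) ∈ natPCS.coh := by
  change ∑' k, kron n k ≤ 1
  have := tsum_kron' n (fun _ => 1)
  simp only [mul_one] at this
  exact this.le

theorem ifz_mem {x : ℕ → ℝ≥0∞} (hx : x ∈ natPCS.coh) {q : X.Web → ℝ≥0∞} (hq : q ∈ X.coh)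
    {r : Mat (Multiset ℕ) X.Web} (hr : r ∈ (impl natPCS X).coh) :
    (Mat.sif X.Web).app (vtens x (vtens (prom q) (prom r))) ∈ X.coh := by
  rw [PCS.mem_coh_iff]
  intro v hv
  have h1 : pairing v q ≤ 1 := (X.mem_coh_iff _).1 hq v hv
  have h2 : ∀ n : ℕ, pairing v (r.app (prom fun k => kron n k)) ≤ 1 := fun n =>
    (X.mem_coh_iff _).1 ((mem_limpl _).1 hr _ (prom_mem (X := natPCS) (kron_mem n))) v hv
  have h3 : pairing v ((Mat.sif X.Web).app (vtens x (vtens (prom q) (prom r)))) =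
      x 0 * pairing v q + ∑' n, x (n + 1) * pairing v (r.app (prom fun k => kron n k)) := by
    simp only [pairing, Mat.app_sif, ← ENNReal.tsum_mul_left, mul_add, ENNReal.tsum_add]
    congr 1
    · exact tsum_congr fun a => by ring
    · rw [ENNReal.tsum_comm]
      exact tsum_congr fun n => tsum_congr fun a => by ring
  rw [h3]
  have h4 : ∑' n, x n ≤ 1 := hx
  refine le_trans ?_ h4
  rw [tsum_eq_zero_add' (f := x) ENNReal.summable]
  refine add_le_add (mul_le_of_le_one_right' h1) (ENNReal.tsum_le_tsum fun n => ?_)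
  exact mul_le_of_le_one_right' (h2 n)

/-- The conditional: contraction, followed by `P ⊗ Q^! ⊗ (cur R)^!`, followed by the conditional
morphism `N ⊗ !X ⊗ !(!N ⊸ X) → X`. -/
def ifz (P : Kl Z natPCS) (Q : Kl Z X) (R : Kl (prod Z natPCS) X) : Kl Z X :=
  mk' ((Mat.sif X.Web).comp
    ((Mat.tens P.1 (Mat.tens (Mat.promo Q.1) (Mat.promo (cur R).1))).comp
      ((Mat.tens (Mat.one _) (Mat.contr Z.Web)).comp (Mat.contr Z.Web)))) fun u hu => by
    rw [Mat.app_comp, Mat.app_comp, Mat.app_comp, Mat.app_contr, Mat.app_tens, Mat.app_one,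
      Mat.app_contr, Mat.app_tens, Mat.app_tens, Mat.app_promo, Mat.app_promo]
    exact ifz_mem (P.app_mem hu) (Q.app_mem hu) ((cur R).app_mem hu)

end Kl

/-- The first projection, as a linear morphism. -/
def fst (X Y : PCS) : Hom (prod X Y) X :=
  ⟨fun p => kron p.1 (Sum.inl p.2), fun u hu => by
    have : Mat.app (fun p : (X.Web ⊕ Y.Web) × X.Web => kron p.1 (Sum.inl p.2)) u =
        fun a => u (Sum.inl a) := by
      funext a; exact tsum_kron (Sum.inl a) u
    rw [this]; exact hu.1⟩

/-- The second projection, as a linear morphism. -/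
def snd (X Y : PCS) : Hom (prod X Y) Y :=
  ⟨fun p => kron p.1 (Sum.inr p.2), fun u hu => by
    have : Mat.app (fun p : (X.Web ⊕ Y.Web) × Y.Web => kron p.1 (Sum.inr p.2)) u =
        fun a => u (Sum.inr a) := by
      funext a; exact tsum_kron (Sum.inr a) u
    rw [this]; exact hu.2⟩

/-! ### Syntax of probabilistic PCF -/

/-- Types. -/
inductive Ty : Type
  | nat : Ty
  | arr : Ty → Ty → Ty

/-- Typed variables, as positions in the list of types of a context. -/
inductive Var : List Ty → Ty → Type
  | zero {Γ : List Ty} {σ : Ty} : Var (σ :: Γ) σ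
  | succ {Γ : List Ty} {σ τ : Ty} : Var Γ σ → Var (τ :: Γ) σ

/-- Typed terms, up to renaming of bound variables. The most recently bound variable is the first
in the list. -/
inductive Term : List Ty → Ty → Type
  | num {Γ : List Ty} : ℕ → Term Γ Ty.nat
  | var {Γ : List Ty} {σ : Ty} : Var Γ σ → Term Γ σ
  | succ {Γ : List Ty} : Term Γ Ty.nat → Term Γ Ty.nat
  | ifz {Γ : List Ty} {σ : Ty} :
      Term Γ Ty.nat → Term Γ σ → Term (Ty.nat :: Γ) σ → Term Γ σ
  | lam {Γ : List Ty} {τ : Ty} (σ : Ty) : Term (σ :: Γ) τ → Term Γ (Ty.arr σ τ)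
  | app {Γ : List Ty} {σ τ : Ty} : Term Γ (Ty.arr σ τ) → Term Γ σ → Term Γ τ
  | dice {Γ : List Ty} : Set.Icc (0 : ℚ) 1 → Term Γ Ty.nat
  | fix {Γ : List Ty} {σ : Ty} : Term Γ (Ty.arr σ σ) → Term Γ σ

/-- Type-preserving maps on variables. -/
abbrev Ren (Γ Δ : List Ty) : Type := ∀ σ : Ty, Var Γ σ → Var Δ σ

/-- Extension of a renaming under a binder. -/
def Ren.lift {Γ Δ : List Ty} {τ : Ty} (r : Ren Γ Δ) : Ren (τ :: Γ) (τ :: Δ)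
  | _, Var.zero => Var.zero
  | _, Var.succ v => Var.succ (r _ v)

/-- Renaming of the free variables of a term. -/
def Term.rename : {Γ Δ : List Ty} → {σ : Ty} → Ren Γ Δ → Term Γ σ → Term Δ σ
  | _, _, _, _, .num n => .num n
  | _, _, _, r, .var v => .var (r _ v)
  | _, _, _, r, .succ M => .succ (M.rename r)
  | _, _, _, r, .ifz M P R => .ifz (M.rename r) (P.rename r) (R.rename r.lift)
  | _, _, _, r, .lam σ M => .lam σ (M.rename r.lift)
  | _, _, _, r, .app M N => .app (M.rename r) (N.rename r)
  | _, _, _, _, .dice p => .dice p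
  | _, _, _, r, .fix M => .fix (M.rename r)

/-- Simultaneous substitutions. -/
abbrev Sub (Γ Δ : List Ty) : Type := ∀ σ : Ty, Var Γ σ → Term Δ σ

/-- Extension of a substitution under a binder. -/
def Sub.lift {Γ Δ : List Ty} {τ : Ty} (s : Sub Γ Δ) : Sub (τ :: Γ) (τ :: Δ)
  | _, Var.zero => .var Var.zero
  | _, Var.succ v => (s _ v).rename fun _ w => Var.succ w

/-- Simultaneous substitution. -/
def Term.subst : {Γ Δ : List Ty} → {σ : Ty} → Sub Γ Δ → Term Γ σ → Term Δ σ
  | _, _, _, _, .num n => .num n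
  | _, _, _, s, .var v => s _ v
  | _, _, _, s, .succ M => .succ (M.subst s)
  | _, _, _, s, .ifz M P R => .ifz (M.subst s) (P.subst s) (R.subst s.lift)
  | _, _, _, s, .lam σ M => .lam σ (M.subst s.lift)
  | _, _, _, s, .app M N => .app (M.subst s) (N.subst s)
  | _, _, _, _, .dice p => .dice p
  | _, _, _, s, .fix M => .fix (M.subst s)

/-- The substitution of the most recently bound variable by `N`. -/
def Sub.single {Γ : List Ty} {σ : Ty} (N : Term Γ σ) : Sub (σ :: Γ) Γ
  | _, Var.zero => N
  | _, Var.succ v => .var v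

/-- The substitution `M[N/x]`, where `x` is the most recently bound variable. -/
def Term.subst1 {Γ : List Ty} {σ τ : Ty} (M : Term (σ :: Γ) τ) (N : Term Γ σ) : Term Γ τ :=
  M.subst (Sub.single N)

/-! ### Weak-head reduction -/

/-- Deterministic one-step reduction. -/
inductive RedDet : {Γ : List Ty} → {σ : Ty} → Term Γ σ → Term Γ σ → Prop
  | beta {Γ : List Ty} {σ τ : Ty} (M : Term (σ :: Γ) τ) (N : Term Γ σ) :
      RedDet (.app (.lam σ M) N) (M.subst1 N)
  | fix {Γ : List Ty} {σ : Ty} (M : Term Γ (Ty.arr σ σ)) : RedDet (.fix M) (.app M (.fix M))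
  | succ {Γ : List Ty} (n : ℕ) : RedDet (Γ := Γ) (.succ (.num n)) (.num (n + 1))
  | ifZero {Γ : List Ty} {σ : Ty} (P : Term Γ σ) (R : Term (Ty.nat :: Γ) σ) :
      RedDet (.ifz (.num 0) P R) P
  | ifSucc {Γ : List Ty} {σ : Ty} (n : ℕ) (P : Term Γ σ) (R : Term (Ty.nat :: Γ) σ) :
      RedDet (.ifz (.num (n + 1)) P R) (R.subst1 (.num n))

/-- `Red M p M'`: the term `M` reduces to `M'` in one step with probability `p`. -/
inductive Red : {Γ : List Ty} → {σ : Ty} → Term Γ σ → ℝ → Term Γ σ → Prop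
  | det {Γ : List Ty} {σ : Ty} {M M' : Term Γ σ} : RedDet M M' → Red M 1 M'
  | diceZero {Γ : List Ty} (p : Set.Icc (0 : ℚ) 1) :
      Red (Γ := Γ) (.dice p) ((p : ℚ) : ℝ) (.num 0)
  | diceOne {Γ : List Ty} (p : Set.Icc (0 : ℚ) 1) :
      Red (Γ := Γ) (.dice p) (1 - ((p : ℚ) : ℝ)) (.num 1)
  | app {Γ : List Ty} {σ τ : Ty} {M M' : Term Γ (Ty.arr σ τ)} {p : ℝ} (N : Term Γ σ) :
      Red M p M' → Red (.app M N) p (.app M' N)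
  | succ {Γ : List Ty} {M M' : Term Γ Ty.nat} {p : ℝ} :
      Red M p M' → Red (.succ M) p (.succ M')
  | ifz {Γ : List Ty} {σ : Ty} {M M' : Term Γ Ty.nat} {p : ℝ} (P : Term Γ σ)
      (R : Term (Ty.nat :: Γ) σ) : Red M p M' → Red (.ifz M P R) p (.ifz M' P R)

/-- A term is weak-normal if no reduction is possible from it. -/
def WeakNormal {Γ : List Ty} {σ : Ty} (M : Term Γ σ) : Prop :=
  ¬ ∃ (p : ℝ) (M' : Term Γ σ), Red M p M'

open Classical in
/-- The stochastic matrix of one-step reduction. -/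
def redMat (Γ : List Ty) (σ : Ty) (M M' : Term Γ σ) : ℝ≥0∞ :=
  if h : ∃ p : ℝ, Red M p M' then ENNReal.ofReal h.choose
  else if M' = M ∧ WeakNormal M then 1 else 0

/-- Powers of a square matrix. -/
def matPow {I : Type} (S : I → I → ℝ≥0∞) : ℕ → I → I → ℝ≥0∞
  | 0 => fun i j => kron i j
  | n + 1 => fun i j => ∑' k, matPow S n i k * S k j

open Classical in
/-- The matrix of the probabilities of convergence to a stationary state. -/
def matInf {I : Type} (S : I → I → ℝ≥0∞) (i j : I) : ℝ≥0∞ :=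
  if S j j = 1 then ⨆ n, matPow S n i j else 0

/-! ### Observation contexts and observational equivalence -/

/-- Typing contexts: lists of typed variables, the most recently bound variable coming first. -/
abbrev Ctx : Type := List (ℕ × Ty)

/-- The variables of a typing context. -/
abbrev Ctx.names (Γ : Ctx) : List ℕ := Γ.map Prod.fst

/-- The types of a typing context. -/
abbrev Ctx.types (Γ : Ctx) : List Ty := Γ.map Prod.snd

/-- The terms of type `σ` in the typing context `Γ`. -/
abbrev Open (Γ : Ctx) (σ : Ty) : Type := Term Γ.types σ

/-- `OCtx Δ τ Θ σ` is the type of observation contexts of type `σ` in the typing context `Θ`, whose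
holes can be filled with terms of type `τ` in the typing context `Δ`. Bound variables of observation
contexts are named, since they can capture the free variables of the terms put in the holes. A hole
can be used in any typing context that contains all the declarations of `Δ`. -/
inductive OCtx (Δ : Ctx) (τ : Ty) : Ctx → Ty → Type
  | hole {Θ : Ctx} : Δ ⊆ Θ → OCtx Δ τ Θ τ
  | num {Θ : Ctx} : ℕ → OCtx Δ τ Θ Ty.nat
  | var {Θ : Ctx} {σ : Ty} (x : ℕ) : (x, σ) ∈ Θ → OCtx Δ τ Θ σ
  | succ {Θ : Ctx} : OCtx Δ τ Θ Ty.nat → OCtx Δ τ Θ Ty.nat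
  | ifz {Θ : Ctx} {σ : Ty} (C : OCtx Δ τ Θ Ty.nat) (D : OCtx Δ τ Θ σ) (z : ℕ)
      (hz : z ∉ Θ.names) (E : OCtx Δ τ ((z, Ty.nat) :: Θ) σ) : OCtx Δ τ Θ σ
  | lam {Θ : Ctx} {φ : Ty} (x : ℕ) (σ : Ty) (hx : x ∉ Θ.names)
      (C : OCtx Δ τ ((x, σ) :: Θ) φ) : OCtx Δ τ Θ (Ty.arr σ φ)
  | app {Θ : Ctx} {σ φ : Ty} : OCtx Δ τ Θ (Ty.arr σ φ) → OCtx Δ τ Θ σ → OCtx Δ τ Θ φ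
  | dice {Θ : Ctx} : Set.Icc (0 : ℚ) 1 → OCtx Δ τ Θ Ty.nat
  | fix {Θ : Ctx} {σ : Ty} : OCtx Δ τ Θ (Ty.arr σ σ) → OCtx Δ τ Θ σ

/-- The first variable of a list of types. -/
def Var.head {Γ : List Ty} {σ τ : Ty} (h : σ = τ) : Var (τ :: Γ) σ :=
  h ▸ Var.zero

open Classical in
/-- The position of a named variable in a typing context. -/
def Ctx.lookup : (Θ : Ctx) → (x : ℕ) → (σ : Ty) → (x, σ) ∈ Θ → Var Θ.types σ
  | [], _, _, h => absurd h List.not_mem_nil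
  | (y, τ) :: Θ, x, σ, h =>
    if e : (x, σ) = (y, τ) then
      Var.head (congrArg Prod.snd e)
    else Var.succ (Ctx.lookup Θ x σ ((List.mem_cons.1 h).resolve_left e))

/-- The declaration at a given position in a typing context. -/
def Ctx.decl : (Δ : Ctx) → {σ : Ty} → Var Δ.types σ → {x : ℕ // (x, σ) ∈ Δ}
  | (x, _) :: _, _, Var.zero => ⟨x, List.mem_cons_self⟩
  | _ :: Δ, _, Var.succ v => ⟨(Ctx.decl Δ v).1, List.mem_cons_of_mem _ (Ctx.decl Δ v).2⟩

/-- The name-preserving renaming from a typing context to a larger one. -/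
def Ctx.incl {Δ Θ : Ctx} (h : Δ ⊆ Θ) : Ren Δ.types Θ.types :=
  fun σ v => Ctx.lookup Θ (Ctx.decl Δ v).1 σ (h (Ctx.decl Δ v).2)

/-- The term `C[M]` obtained by filling all the holes of `C` with `M`. -/
def OCtx.fill {Δ : Ctx} {τ : Ty} (M : Open Δ τ) :
    {Θ : Ctx} → {σ : Ty} → OCtx Δ τ Θ σ → Open Θ σ
  | _, _, .hole h => M.rename (Ctx.incl h)
  | _, _, .num n => .num n
  | Θ, σ, .var x h => .var (Ctx.lookup Θ x σ h)
  | _, _, .succ C => .succ (C.fill M)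
  | _, _, .ifz C D _ _ E => .ifz (C.fill M) (D.fill M) (E.fill M)
  | _, _, .lam _ σ _ C => .lam σ (C.fill M)
  | _, _, .app C D => .app (C.fill M) (D.fill M)
  | _, _, .dice p => .dice p
  | _, _, .fix C => .fix (C.fill M)

/-- Observational equivalence: in every closing observation context of ground type, the two terms
have the same probability of reducing to `0`. -/
def ObsEq {Γ : Ctx} {σ : Ty} (M M' : Open Γ σ) : Prop :=
  ∀ C : OCtx Γ σ [] Ty.nat,
    matInf (redMat [] Ty.nat) (C.fill M) (.num 0) = matInf (redMat [] Ty.nat) (C.fill M') (.num 0)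

/-! ### Interpretation of terms -/

/-- The interpretation of types. -/
def tySem : Ty → PCS
  | .nat => natPCS
  | .arr σ τ => impl (tySem σ) (tySem τ)

/-- The interpretation of typing contexts. -/
def ctxSem : List Ty → PCS
  | [] => top
  | σ :: Γ => prod (ctxSem Γ) (tySem σ)

/-- The linear projection associated with a variable. -/
def Var.proj : {Γ : List Ty} → {σ : Ty} → Var Γ σ → Hom (ctxSem Γ) (tySem σ)
  | _ :: Γ, σ, .zero => snd (ctxSem Γ) (tySem σ)
  | τ :: Γ, _, .succ v => Hom.comp v.proj (fst (ctxSem Γ) (tySem τ))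

/-- The distribution `p · 0 + (1 - p) · 1`. -/
def diceVec (p : Set.Icc (0 : ℚ) 1) : ℕ → ℝ≥0∞ := fun n =>
  ENNReal.ofReal ((p : ℚ) : ℝ) * kron 0 n + ENNReal.ofReal (1 - ((p : ℚ) : ℝ)) * kron 1 n

theorem diceVec_mem (p : Set.Icc (0 : ℚ) 1) : diceVec p ∈ natPCS.coh := by
  change ∑' n, diceVec p n ≤ 1
  have h := fun k : ℕ => tsum_kron' k (fun _ => 1)
  simp only [mul_one] at h
  have h0 : (0 : ℝ) ≤ ((p : ℚ) : ℝ) := by exact_mod_cast p.2.1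
  have h1 : (0 : ℝ) ≤ 1 - ((p : ℚ) : ℝ) := by
    rw [sub_nonneg]; exact_mod_cast p.2.2
  simp only [diceVec, ENNReal.tsum_add, ENNReal.tsum_mul_left, h, mul_one]
  rw [← ENNReal.ofReal_add h0 h1]
  simp

/-- The interpretation of terms, as morphisms of the Kleisli category. -/
def Term.sem : {Γ : List Ty} → {σ : Ty} → Term Γ σ → Kl (ctxSem Γ) (tySem σ)
  | _, _, .num n => Kl.const (Y := natPCS) (fun k => kron n k) (Kl.kron_mem n)
  | _, _, .var v => Kl.ofLin v.proj
  | _, _, .succ M => Hom.comp Kl.ssuc M.sem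
  | _, _, .ifz M P R => Kl.ifz M.sem P.sem R.sem
  | _, _, .lam _ M => Kl.cur M.sem
  | _, _, .app M N => Kl.app M.sem N.sem
  | _, _, .dice p => Kl.const (Y := natPCS) (diceVec p) (diceVec_mem p)
  | _, _, .fix (σ := σ) M => Kl.comp (Kl.sfix (tySem σ)) M.sem

end PPCF

end

open scoped ENNReal NNReal
noncomputable section
namespace PPCF
/-! ### Renaming and substitution -/

/-! The limit probabilities of a closed ground term can be read off any matrix that bounds them from
both sides, and filling a context lifts to an operation on such matrices. Hence the behaviour of
`C[M]` depends on `M` only through its interpretation.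

The two bounds come from two logical relations between vectors and closed terms, both instances of
`GroundRel`. In `upperRel` a vector at world `k` dominates the probabilities of reaching each
numeral within `k` steps. In `lowerRel` it is dominated by the limit probabilities, and worlds play
no role. Both extend to arrow types by "related arguments give related results". They are closed
under mixtures of one-step reducts (`rel_steps`): since `(·)N` is an evaluation position, this
property passes from the ground type to all types.

The fundamental lemma `valid_sem` asks two more things of a relation, collected in `Compat`:
evaluation positions filled with ground terms, and fixpoints. For `upperRel` both go by induction on
the number of steps, and the fixpoint case uses only that the denotation of `fix` is a fixed point.
For `lowerRel` the vector is a supremum of approximants and the relation is closed under increasing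
suprema.

For contexts, `OCtx.exists_valid` builds from the interpretation of `M` one matrix that is valid for
`C[N]` in every compatible relation in which this interpretation is valid for `N`.
`prInf_eq_of_valid` then computes the convergence probabilities of `C[M]` and `C[M']` by the same
matrix. Working with validity instead of equality of interpretations avoids any semantic
substitution or renaming lemma, and any invariance of the model under reduction. Coherence of
vectors is never needed either, because all series converge in `ℝ≥0∞`. -/

theorem Ren.lift_comp {Γ Δ Θ : List Ty} {τ : Ty} (r : Ren Γ Δ) (r' : Ren Δ Θ) :
    (fun σ v => (r'.lift (τ := τ)) σ (r.lift σ v)) = Ren.lift fun σ v => r' σ (r σ v) := by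
  funext σ v; cases v <;> rfl

theorem Term.rename_rename : {Γ Δ Θ : List Ty} → {σ : Ty} → (M : Term Γ σ) → (r : Ren Γ Δ) →
    (r' : Ren Δ Θ) → (M.rename r).rename r' = M.rename fun σ v => r' σ (r σ v)
  | _, _, _, _, .num n, _, _ => rfl
  | _, _, _, _, .var v, _, _ => rfl
  | _, _, _, _, .succ M, r, r' => by simp only [rename, M.rename_rename]
  | _, _, _, _, .ifz M P R, r, r' => by
    simp only [rename, M.rename_rename, P.rename_rename, R.rename_rename, Ren.lift_comp]
  | _, _, _, _, .lam σ M, r, r' => by simp only [rename, M.rename_rename, Ren.lift_comp]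
  | _, _, _, _, .app M N, r, r' => by simp only [rename, M.rename_rename, N.rename_rename]
  | _, _, _, _, .dice p, _, _ => rfl
  | _, _, _, _, .fix M, r, r' => by simp only [rename, M.rename_rename]

theorem Sub.lift_comp_ren {Γ Δ Θ : List Ty} {τ : Ty} (r : Ren Γ Δ) (s : Sub Δ Θ) :
    (fun σ v => (s.lift (τ := τ)) σ (r.lift σ v)) = Sub.lift fun σ v => s σ (r σ v) := by
  funext σ v; cases v <;> rfl

/-- The three fusion laws `subst_rename`, `rename_subst` and `subst_subst` are proved in this order
because going under a binder weakens the substituted terms, so each law relies on the earlier ones.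
-/
theorem Term.subst_rename : {Γ Δ Θ : List Ty} → {σ : Ty} → (M : Term Γ σ) → (r : Ren Γ Δ) →
    (s : Sub Δ Θ) → (M.rename r).subst s = M.subst fun σ v => s σ (r σ v)
  | _, _, _, _, .num n, _, _ => rfl
  | _, _, _, _, .var v, _, _ => rfl
  | _, _, _, _, .succ M, r, s => by simp only [rename, subst, M.subst_rename]
  | _, _, _, _, .ifz M P R, r, s => by
    simp only [rename, subst, M.subst_rename, P.subst_rename, R.subst_rename, Sub.lift_comp_ren]
  | _, _, _, _, .lam σ M, r, s => by simp only [rename, subst, M.subst_rename, Sub.lift_comp_ren]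
  | _, _, _, _, .app M N, r, s => by simp only [rename, subst, M.subst_rename, N.subst_rename]
  | _, _, _, _, .dice p, _, _ => rfl
  | _, _, _, _, .fix M, r, s => by simp only [rename, subst, M.subst_rename]

theorem Sub.lift_rename {Γ Δ Θ : List Ty} {τ : Ty} (s : Sub Γ Δ) (r : Ren Δ Θ) :
    (fun σ v => ((s.lift (τ := τ)) σ v).rename r.lift) =
      Sub.lift fun σ v => (s σ v).rename r := by
  funext σ v
  cases v with
  | zero => rfl
  | succ v => simp only [Sub.lift, Term.rename_rename]; rfl

theorem Term.rename_subst : {Γ Δ Θ : List Ty} → {σ : Ty} → (M : Term Γ σ) → (s : Sub Γ Δ) →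
    (r : Ren Δ Θ) → (M.subst s).rename r = M.subst fun σ v => (s σ v).rename r
  | _, _, _, _, .num n, _, _ => rfl
  | _, _, _, _, .var v, _, _ => rfl
  | _, _, _, _, .succ M, s, r => by simp only [rename, subst, M.rename_subst]
  | _, _, _, _, .ifz M P R, s, r => by
    simp only [rename, subst, M.rename_subst, P.rename_subst, R.rename_subst, Sub.lift_rename]
  | _, _, _, _, .lam σ M, s, r => by simp only [rename, subst, M.rename_subst, Sub.lift_rename]
  | _, _, _, _, .app M N, s, r => by simp only [rename, subst, M.rename_subst, N.rename_subst]
  | _, _, _, _, .dice p, _, _ => rfl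
  | _, _, _, _, .fix M, s, r => by simp only [rename, subst, M.rename_subst]

theorem Sub.lift_subst {Γ Δ Θ : List Ty} {τ : Ty} (s : Sub Γ Δ) (s' : Sub Δ Θ) :
    (fun σ v => ((s.lift (τ := τ)) σ v).subst s'.lift) =
      Sub.lift fun σ v => (s σ v).subst s' := by
  funext σ v
  cases v with
  | zero => rfl
  | succ v => simp only [Sub.lift, Term.subst_rename, Term.rename_subst]

theorem Term.subst_subst : {Γ Δ Θ : List Ty} → {σ : Ty} → (M : Term Γ σ) → (s : Sub Γ Δ) →
    (s' : Sub Δ Θ) → (M.subst s).subst s' = M.subst fun σ v => (s σ v).subst s'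
  | _, _, _, _, .num n, _, _ => rfl
  | _, _, _, _, .var v, _, _ => rfl
  | _, _, _, _, .succ M, s, s' => by simp only [subst, M.subst_subst]
  | _, _, _, _, .ifz M P R, s, s' => by
    simp only [subst, M.subst_subst, P.subst_subst, R.subst_subst, Sub.lift_subst]
  | _, _, _, _, .lam σ M, s, s' => by simp only [subst, M.subst_subst, Sub.lift_subst]
  | _, _, _, _, .app M N, s, s' => by simp only [subst, M.subst_subst, N.subst_subst]
  | _, _, _, _, .dice p, _, _ => rfl
  | _, _, _, _, .fix M, s, s' => by simp only [subst, M.subst_subst]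

theorem Sub.lift_var {Γ : List Ty} {τ : Ty} :
    Sub.lift (τ := τ) (fun σ (v : Var Γ σ) => Term.var v) = fun _ v => .var v := by
  funext σ v; cases v <;> rfl

theorem Term.subst_var : {Γ : List Ty} → {σ : Ty} → (M : Term Γ σ) →
    M.subst (fun _ v => .var v) = M
  | _, _, .num n => rfl
  | _, _, .var v => rfl
  | _, _, .succ M => by simp only [subst, M.subst_var]
  | _, _, .ifz M P R => by simp only [subst, M.subst_var, P.subst_var, Sub.lift_var, R.subst_var]
  | _, _, .lam σ M => by simp only [subst, Sub.lift_var, M.subst_var]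
  | _, _, .app M N => by simp only [subst, M.subst_var, N.subst_var]
  | _, _, .dice p => rfl
  | _, _, .fix M => by simp only [subst, M.subst_var]

/-- Extension of a substitution by a term. -/
def Sub.cons {Γ Δ : List Ty} {τ : Ty} (N : Term Δ τ) (s : Sub Γ Δ) : Sub (τ :: Γ) Δ
  | _, Var.zero => N
  | _, Var.succ v => s _ v

/-- What the syntactic part is for: after a closing substitution, firing a redex that binds a
variable amounts to extending that substitution by the argument. -/
theorem Term.subst_lift_subst1 {Γ Δ : List Ty} {σ τ : Ty} (M : Term (τ :: Γ) σ) (s : Sub Γ Δ)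
    (N : Term Δ τ) : (M.subst s.lift).subst1 N = M.subst (Sub.cons N s) := by
  rw [subst1, subst_subst]
  congr 1
  funext σ v
  cases v with
  | zero => rfl
  | succ v =>
    simp only [Sub.lift, subst_rename]
    exact (s _ v).subst_var

/-! ### One-step reduction of closed terms -/

theorem WeakNormal.num {Γ : List Ty} (n : ℕ) : WeakNormal (Term.num (Γ := Γ) n) := by
  rintro ⟨p, M, h⟩
  cases h with
  | det h => cases h

theorem Red.not_weakNormal {Γ : List Ty} {σ : Ty} {M M' : Term Γ σ} {p : ℝ} (h : Red M p M') :
    ¬ WeakNormal M := fun hM => hM ⟨p, M', h⟩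

/-- Progress. A principal subterm that cannot reduce is a canonical form, and then the enclosing
term is itself a redex. -/
theorem closed_cases : {σ : Ty} → (M : Term [] σ) →
    ¬ WeakNormal M ∨
      match σ, M with
      | .nat, M => ∃ n, M = .num n
      | .arr _ _, M => ∃ M', M = .lam _ M'
  | _, .num n => Or.inr ⟨n, rfl⟩
  | _, .lam _ M => Or.inr ⟨M, rfl⟩
  | _, .dice p => Or.inl (Red.diceZero p).not_weakNormal
  | _, .fix M => Or.inl (Red.det (.fix M)).not_weakNormal
  | _, .succ M => by
    rcases closed_cases M with h | ⟨n, rfl⟩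
    · obtain ⟨p, M', h⟩ := not_not.1 h
      exact Or.inl h.succ.not_weakNormal
    · exact Or.inl (Red.det (.succ n)).not_weakNormal
  | _, .ifz M P R => by
    rcases closed_cases M with h | ⟨n, rfl⟩
    · obtain ⟨p, M', h⟩ := not_not.1 h
      exact Or.inl (h.ifz P R).not_weakNormal
    · cases n with
      | zero => exact Or.inl (Red.det (.ifZero P R)).not_weakNormal
      | succ n => exact Or.inl (Red.det (.ifSucc n P R)).not_weakNormal
  | _, .app M N => by
    rcases closed_cases M with h | ⟨M', rfl⟩
    · obtain ⟨p, M', h⟩ := not_not.1 h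
      exact Or.inl (h.app N).not_weakNormal
    · exact Or.inl (Red.det (.beta M' N)).not_weakNormal

theorem closed_nat_cases (M : Term [] .nat) : ¬ WeakNormal M ∨ ∃ n, M = .num n := closed_cases M

/-- The expectation of `f` after one step of reduction from `M`. -/
def row {σ : Ty} (M : Term [] σ) (f : Term [] σ → ℝ≥0∞) : ℝ≥0∞ := ∑' X, redMat [] σ M X * f X

/-- `M` is reducible, and its one-step reducts are the `N i` with probabilities `p i`. -/
structure Steps {σ : Ty} {ι : Type} (M : Term [] σ) (p : ι → ℝ≥0∞) (N : ι → Term [] σ) : Prop where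
  red : ¬ WeakNormal M
  row_eq : ∀ f, row M f = ∑' i, p i * f (N i)

/-- One-hole evaluation contexts of depth one, as maps on terms. -/
structure Frame {σ τ : Ty} (F : Term [] σ → Term [] τ) : Prop where
  inj : Function.Injective F
  red : ∀ M q X, ¬ WeakNormal M → (Red (F M) q X ↔ ∃ M', Red M q M' ∧ X = F M')

theorem Frame.app {σ τ : Ty} (N : Term [] σ) :
    Frame (fun M : Term [] (.arr σ τ) => Term.app M N) where
  inj M M' h := by injection h
  red M q X hM := by
    constructor
    · intro h
      cases h with
      | det h => cases h with
        | beta M N => exact absurd (by rintro ⟨p, M', h⟩; cases h with | det h => cases h) hM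
      | app _ h => exact ⟨_, h, rfl⟩
    · rintro ⟨M', h, rfl⟩
      exact h.app N

theorem Frame.succ : Frame (fun M : Term [] .nat => Term.succ M) where
  inj M M' h := by injection h
  red M q X hM := by
    constructor
    · intro h
      cases h with
      | det h => cases h with
        | succ n => exact absurd (WeakNormal.num n) hM
      | succ h => exact ⟨_, h, rfl⟩
    · rintro ⟨M', h, rfl⟩
      exact h.succ

theorem Frame.ifz {σ : Ty} (P : Term [] σ) (R : Term [.nat] σ) :
    Frame (fun M : Term [] .nat => Term.ifz M P R) where
  inj M M' h := by injection h
  red M q X hM := by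
    constructor
    · intro h
      cases h with
      | det h => cases h with
        | ifZero => exact absurd (WeakNormal.num 0) hM
        | ifSucc n => exact absurd (WeakNormal.num (n + 1)) hM
      | ifz _ _ h => exact ⟨_, h, rfl⟩
    · rintro ⟨M', h, rfl⟩
      exact h.ifz P R

theorem Frame.row {σ τ : Ty} {F : Term [] σ → Term [] τ} (hF : Frame F) {M : Term [] σ}
    (hM : ¬ WeakNormal M) (f : Term [] τ → ℝ≥0∞) : row (F M) f = row M fun X => f (F X) := by
  have hFM : ¬ WeakNormal (F M) := by
    obtain ⟨p, M', h⟩ := not_not.1 hM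
    exact ((hF.red M p _ hM).2 ⟨M', h, rfl⟩).not_weakNormal
  rw [PPCF.row, ← hF.inj.tsum_eq]
  · refine tsum_congr fun X => ?_
    have h : ∀ p, Red (F M) p (F X) ↔ Red M p X := fun p => by
      rw [hF.red M p _ hM]
      exact ⟨fun ⟨M', h, e⟩ => hF.inj e ▸ h, fun h => ⟨X, h, rfl⟩⟩
    -- `redMat` takes its value by choice among the possible probabilities. Equal predicates yield
    -- the same choice, so uniqueness of the probability is not required here.
    have key : ∀ Q Q' : ℝ → Prop, Q = Q' → (open Classical in
        (if h : ∃ p, Q p then ENNReal.ofReal h.choose else 0) =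
          if h : ∃ p, Q' p then ENNReal.ofReal h.choose else 0) := by
      rintro Q _ rfl; rfl
    simp only [redMat, hM, hFM, and_false, if_false]
    rw [key _ _ (funext fun p => propext (h p))]
  · intro X hX
    by_contra hX'
    refine hX ?_
    have h : ¬ ∃ p, Red (F M) p X := by
      rintro ⟨p, h⟩
      obtain ⟨M', -, rfl⟩ := (hF.red M p _ hM).1 h
      exact hX' ⟨M', rfl⟩
    simp [redMat, h, hFM]

theorem Steps.frame {σ τ : Ty} {F : Term [] σ → Term [] τ} (hF : Frame F) {ι : Type}
    {M : Term [] σ} {p : ι → ℝ≥0∞} {N : ι → Term [] σ} (h : Steps M p N) :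
    Steps (F M) p fun i => F (N i) where
  red := by
    obtain ⟨p, M', h'⟩ := not_not.1 h.red
    exact ((hF.red M p _ h.red).2 ⟨M', h', rfl⟩).not_weakNormal
  row_eq f := by rw [hF.row h.red, h.row_eq]

theorem Steps.self {σ : Ty} {M : Term [] σ} (h : ¬ WeakNormal M) :
    Steps M (redMat [] σ M) fun X => X := ⟨h, fun _ => rfl⟩

/-- Uniqueness of the probability is what determines the value chosen in `redMat`. -/
theorem redMat_of_red {σ : Ty} {M X : Term [] σ} {p : ℝ} (h : ∀ q, Red M q X ↔ q = p) :
    redMat [] σ M X = ENNReal.ofReal p := by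
  have hp : ∃ q, Red M q X := ⟨p, (h p).2 rfl⟩
  rw [redMat, dif_pos hp, (h _).1 hp.choose_spec]

theorem redMat_of_not_red {σ : Ty} {M X : Term [] σ} (hM : ¬ WeakNormal M)
    (h : ∀ q, ¬ Red M q X) : redMat [] σ M X = 0 := by
  simp [redMat, h, hM]

theorem Steps.det {σ : Ty} {M M' : Term [] σ} (h : ∀ q X, Red M q X ↔ q = 1 ∧ X = M') :
    Steps M (fun _ : Unit => 1) fun _ => M' := by
  have hM : ¬ WeakNormal M := ((h 1 M').2 ⟨rfl, rfl⟩).not_weakNormal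
  refine ⟨hM, fun f => ?_⟩
  rw [row, tsum_eq_single M', redMat_of_red (p := 1) (by simp [h])]
  · simp
  · intro X hX
    rw [redMat_of_not_red hM (by simp [h, hX]), zero_mul]

theorem Steps.beta {σ τ : Ty} (M : Term [σ] τ) (N : Term [] σ) :
    Steps (.app (.lam σ M) N) (fun _ : Unit => 1) fun _ => M.subst1 N := by
  refine .det fun q X => ⟨fun h => ?_, ?_⟩
  · cases h with
    | det h => cases h; exact ⟨rfl, rfl⟩
    | app _ h => cases h with | det h => cases h
  · rintro ⟨rfl, rfl⟩; exact .det (.beta M N)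

theorem Steps.fix {σ : Ty} (M : Term [] (.arr σ σ)) :
    Steps (.fix M) (fun _ : Unit => 1) fun _ => .app M (.fix M) := by
  refine .det fun q X => ⟨fun h => ?_, ?_⟩
  · cases h with
    | det h => cases h; exact ⟨rfl, rfl⟩
  · rintro ⟨rfl, rfl⟩; exact .det (.fix M)

theorem Steps.succ (n : ℕ) :
    Steps (.succ (.num n)) (fun _ : Unit => 1) fun _ => .num (n + 1) := by
  refine .det fun q X => ⟨fun h => ?_, ?_⟩
  · cases h with
    | det h => cases h; exact ⟨rfl, rfl⟩
    | succ h => exact absurd (WeakNormal.num n) h.not_weakNormal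
  · rintro ⟨rfl, rfl⟩; exact .det (.succ n)

theorem Steps.ifZero {σ : Ty} (P : Term [] σ) (R : Term [.nat] σ) :
    Steps (.ifz (.num 0) P R) (fun _ : Unit => 1) fun _ => P := by
  refine .det fun q X => ⟨fun h => ?_, ?_⟩
  · cases h with
    | det h => cases h; exact ⟨rfl, rfl⟩
    | ifz _ _ h => exact absurd (WeakNormal.num 0) h.not_weakNormal
  · rintro ⟨rfl, rfl⟩; exact .det (.ifZero _ R)

theorem Steps.ifSucc {σ : Ty} (n : ℕ) (P : Term [] σ) (R : Term [.nat] σ) :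
    Steps (.ifz (.num (n + 1)) P R) (fun _ : Unit => 1) fun _ => R.subst1 (.num n) := by
  refine .det fun q X => ⟨fun h => ?_, ?_⟩
  · cases h with
    | det h => cases h; exact ⟨rfl, rfl⟩
    | ifz _ _ h => exact absurd (WeakNormal.num (n + 1)) h.not_weakNormal
  · rintro ⟨rfl, rfl⟩; exact .det (.ifSucc n P R)

theorem tsum_diceVec (p : Set.Icc (0 : ℚ) 1) (f : ℕ → ℝ≥0∞) : ∑' n, diceVec p n * f n =
    ENNReal.ofReal ((p : ℚ) : ℝ) * f 0 + ENNReal.ofReal (1 - ((p : ℚ) : ℝ)) * f 1 := by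
  simp only [diceVec, add_mul, ENNReal.tsum_add, mul_assoc, ENNReal.tsum_mul_left, tsum_kron']

/-- Reducts are indexed by all of `ℕ` with weights `diceVec p`, so that the weights are literally
the denotation of the term. The two outcomes are distinct numerals, hence their probabilities never
compete for one matrix entry. -/
theorem Steps.dice (p : Set.Icc (0 : ℚ) 1) :
    Steps (.dice p) (diceVec p) fun n => .num n := by
  have hM : ¬ WeakNormal (Term.dice (Γ := []) p) := (Red.diceZero p).not_weakNormal
  have inv : ∀ q X, Red (Term.dice (Γ := []) p) q X →
      (q = ((p : ℚ) : ℝ) ∧ X = .num 0) ∨ (q = 1 - ((p : ℚ) : ℝ) ∧ X = .num 1) := by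
    intro q X h
    cases h with
    | det h => cases h
    | diceZero => exact Or.inl ⟨rfl, rfl⟩
    | diceOne => exact Or.inr ⟨rfl, rfl⟩
  refine ⟨hM, fun f => ?_⟩
  have h0 : redMat [] .nat (.dice p) (.num 0) = ENNReal.ofReal ((p : ℚ) : ℝ) :=
    redMat_of_red fun q => ⟨fun h => by simpa using inv _ _ h, by rintro rfl; exact .diceZero p⟩
  have h1 : redMat [] .nat (.dice p) (.num 1) = ENNReal.ofReal (1 - ((p : ℚ) : ℝ)) :=
    redMat_of_red fun q => ⟨fun h => by simpa using inv _ _ h, by rintro rfl; exact .diceOne p⟩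
  have hinj : Function.Injective (fun n => Term.num (Γ := []) n) := fun m n h => by injection h
  rw [row, ← hinj.tsum_eq, tsum_diceVec]
  · rw [tsum_eq_sum (s := {0, 1}), Finset.sum_pair zero_ne_one, h0, h1]
    intro n hn
    simp only [Finset.mem_insert, Finset.mem_singleton, not_or] at hn
    rw [redMat_of_not_red hM, zero_mul]
    intro q h
    rcases inv q _ h with ⟨-, h⟩ | ⟨-, h⟩ <;> injection h
    exacts [hn.1 ‹_›, hn.2 ‹_›]
  · intro X hX
    by_contra hX'
    refine hX ?_
    simp only
    rw [redMat_of_not_red hM, zero_mul]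
    intro q h
    rcases inv q _ h with ⟨-, rfl⟩ | ⟨-, rfl⟩
    exacts [hX' ⟨0, rfl⟩, hX' ⟨1, rfl⟩]

/-! ### Probability of convergence -/

/-- The probability that `M` reduces to `n` in at most `k` steps. -/
def pr (k : ℕ) (M : Term [] .nat) (n : ℕ) : ℝ≥0∞ := matPow (redMat [] .nat) k M (.num n)

/-- Powers are defined by adding a last step, whereas reduction arguments peel off the first one. -/
theorem matPow_succ' {I : Type} (S : I → I → ℝ≥0∞) (n : ℕ) (i j : I) :
    matPow S (n + 1) i j = ∑' k, S i k * matPow S n k j := by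
  induction n generalizing j with
  | zero =>
    simp only [matPow]
    rw [tsum_kron' i fun k => S k j]
    simp only [mul_comm (S i _), tsum_kron]
  | succ n ih =>
    rw [matPow]
    simp only [ih, ← ENNReal.tsum_mul_right]
    rw [ENNReal.tsum_comm]
    refine tsum_congr fun k => ?_
    rw [matPow, ← ENNReal.tsum_mul_left]
    exact tsum_congr fun l => by ring

theorem pr_succ (k : ℕ) (M : Term [] .nat) (n : ℕ) : pr (k + 1) M n = row M fun X => pr k X n :=
  matPow_succ' _ _ _ _

theorem redMat_num (n : ℕ) (X : Term [] .nat) : redMat [] .nat (.num n) X = kron (.num n) X := by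
  have h : ¬ ∃ p, Red (.num n) p X := fun ⟨p, h⟩ => WeakNormal.num n ⟨p, X, h⟩
  rw [redMat, dif_neg h, kron]
  by_cases e : Term.num n = X
  · rw [if_pos e, if_pos ⟨e.symm, WeakNormal.num n⟩]
  · rw [if_neg e, if_neg fun h => e h.1.symm]

theorem row_num (n : ℕ) (f : Term [] .nat → ℝ≥0∞) : row (.num n) f = f (.num n) := by
  simp only [row, redMat_num, tsum_kron']

theorem pr_num (k n m : ℕ) : pr k (.num n) m = kron n m := by
  induction k with
  | zero => simp [pr, matPow, kron]
  | succ k ih => rw [pr_succ, row_num, ih]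

theorem pr_zero {M : Term [] .nat} (hM : ¬ WeakNormal M) (n : ℕ) : pr 0 M n = 0 := by
  refine if_neg ?_
  rintro rfl
  exact hM (.num n)

/-- Numerals are absorbing states, so the mass that has reached one stays there. -/
theorem pr_mono (M : Term [] .nat) (n : ℕ) : Monotone fun k => pr k M n := by
  refine monotone_nat_of_le_succ fun k => ?_
  induction k generalizing M with
  | zero =>
    rcases closed_nat_cases M with hM | ⟨m, rfl⟩
    · simp only [pr_zero hM, zero_le]
    · simp only [pr_num, le_refl]
  | succ k ih =>
    simp only [pr_succ _ M]
    exact ENNReal.tsum_le_tsum fun X => mul_le_mul' le_rfl (ih X)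

/-- The probability that `M` reduces to `n`. -/
def prInf (M : Term [] .nat) (n : ℕ) : ℝ≥0∞ := ⨆ k, pr k M n

theorem matInf_num (M : Term [] .nat) (n : ℕ) :
    matInf (redMat [] .nat) M (.num n) = prInf M n := by
  rw [matInf, redMat_num, kron_self, if_pos rfl]; rfl

/-- Monotone convergence for sums; every continuity statement below rests on it. -/
theorem tsum_iSup_of_monotone {A : Type} {f : ℕ → A → ℝ≥0∞} (hf : Monotone f) :
    ∑' a, ⨆ n, f n a = ⨆ n, ∑' a, f n a := by
  simp only [ENNReal.tsum_eq_iSup_sum]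
  rw [iSup_comm]
  refine iSup_congr fun s => ?_
  exact ENNReal.finsetSum_iSup_of_monotone fun a i j h => hf h a

/-- First-step analysis in the limit: the shift by one step between `M` and its reducts disappears
in the supremum. -/
theorem Steps.prInf {ι : Type} {M : Term [] .nat} {p : ι → ℝ≥0∞} {N : ι → Term [] .nat}
    (h : Steps M p N) (n : ℕ) : ∑' i, p i * prInf (N i) n = prInf M n := by
  simp only [PPCF.prInf, ENNReal.mul_iSup]
  rw [tsum_iSup_of_monotone (f := fun k i => p i * pr k (N i) n) fun i j hij a => mul_le_mul' le_rfl (pr_mono (N a) n hij)]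
  refine le_antisymm (iSup_le fun k => ?_) (iSup_le fun k => ?_)
  · rw [← h.row_eq fun X => pr k X n, ← pr_succ]
    exact le_iSup (fun k => pr k M n) (k + 1)
  · refine (pr_mono M n k.le_succ).trans ?_
    simp only [Nat.succ_eq_add_one]
    rw [pr_succ, h.row_eq]
    exact le_iSup (fun k => ∑' i, p i * pr k (N i) n) k
/-! ### Continuity of matrix application -/

theorem prom_mono {A : Type} {u v : A → ℝ≥0∞} (h : u ≤ v) : prom u ≤ prom v := by
  intro m
  simp only [prom]
  induction m using Multiset.induction_on with
  | empty => simp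
  | cons a m ih =>
    simp only [Multiset.map_cons, Multiset.prod_cons]
    exact mul_le_mul' (h a) ih

theorem prom_iSup {A : Type} {u : ℕ → A → ℝ≥0∞} (hu : Monotone u) (m : Multiset A) :
    prom (fun a => ⨆ n, u n a) m = ⨆ n, prom (u n) m := by
  induction m using Multiset.induction_on with
  | empty => simp [prom]
  | cons a m ih =>
    have h : ∀ v : A → ℝ≥0∞, prom v (a ::ₘ m) = v a * prom v m := fun v => by simp [prom]
    simp only [h, ih]
    simp only [ENNReal.iSup_mul, ENNReal.mul_iSup]
    -- The double supremum over both factors is attained along the diagonal, since both sequences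
    -- increase.
    refine le_antisymm (iSup₂_le fun i j => ?_) 
      (iSup_le fun n => le_iSup₂_of_le (f := fun j i => u i a * prom (u j) m) n n le_rfl)
    exact le_iSup_of_le (max j i) <| mul_le_mul'
      (hu (le_max_left j i) a) (prom_mono (hu (le_max_right j i)) m)

namespace Mat
variable {A B Z : Type}

theorem app_mono {t t' : Mat A B} {u u' : A → ℝ≥0∞} (ht : t ≤ t') (hu : u ≤ u') :
    t.app u ≤ t'.app u' :=
  fun _ => ENNReal.tsum_le_tsum fun a => mul_le_mul' (ht _) (hu a)

theorem app_iSup_left {t : ℕ → Mat A B} (ht : Monotone t) (u : A → ℝ≥0∞) :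
    Mat.app (fun p => ⨆ n, t n p) u = fun b => ⨆ n, (t n).app u b := by
  funext b
  simp only [app, ENNReal.iSup_mul]
  exact tsum_iSup_of_monotone (f := fun n a => t n (a, b) * u a) fun i j h a =>
    mul_le_mul' (ht h _) le_rfl

theorem app_iSup_right (t : Mat A B) {u : ℕ → A → ℝ≥0∞} (hu : Monotone u) :
    t.app (fun a => ⨆ n, u n a) = fun b => ⨆ n, t.app (u n) b := by
  funext b
  simp only [app, ENNReal.mul_iSup]
  exact tsum_iSup_of_monotone (f := fun n a => t (a, b) * u n a) fun i j h a =>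
    mul_le_mul' le_rfl (hu h _)

theorem app_prom_iSup (t : Mat (Multiset A) B) {u : ℕ → A → ℝ≥0∞} (hu : Monotone u) :
    t.app (prom fun a => ⨆ n, u n a) = fun b => ⨆ n, t.app (prom (u n)) b := by
  rw [funext (prom_iSup hu), app_iSup_right t fun i j h => prom_mono (hu h)]

theorem app_tsum {ι : Type} (p : ι → ℝ≥0∞) (t : ι → Mat A B) (u : A → ℝ≥0∞) :
    Mat.app (fun q => ∑' i, p i * t i q) u = fun b => ∑' i, p i * (t i).app u b := by
  funext b
  simp only [app, ← ENNReal.tsum_mul_right, ← ENNReal.tsum_mul_left]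
  rw [ENNReal.tsum_comm]
  exact tsum_congr fun i => tsum_congr fun a => by ring

/-! ### The fixpoint and the conditional on promoted vectors -/

theorem app_sfixN_succ (n : ℕ) (t : Mat (Multiset A) A) :
    (sfixN A (n + 1)).app (prom t) = t.app (prom ((sfixN A n).app (prom t))) := by
  rw [sfixN, app_kapp, app_der]

theorem app_sfix (t : Mat (Multiset A) A) :
    (sfix A).app (prom t) = fun a => ⨆ n, (sfixN A n).app (prom t) a :=
  app_iSup_left (Kl.sfixN_mono A) _

theorem app_sfixN_mono (t : Mat (Multiset A) A) : Monotone fun n => (sfixN A n).app (prom t) :=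
  fun _ _ h => app_mono (Kl.sfixN_mono A h) le_rfl

/-- Kleene's argument: by continuity, applying `t` to the supremum of the approximants gives the
supremum of the same chain shifted by one. -/
theorem app_sfix_eq (t : Mat (Multiset A) A) :
    t.app (prom ((sfix A).app (prom t))) = (sfix A).app (prom t) := by
  rw [app_sfix, app_prom_iSup t (app_sfixN_mono t)]
  funext a
  simp only [← app_sfixN_succ]
  exact Monotone.iSup_nat_add (f := fun n => (sfixN A n).app (prom t) a)
    (fun _ _ h => app_sfixN_mono t h a) 1

/-- The conditional of Kleisli matrices. -/
def ifz (P : Mat (Multiset Z) ℕ) (Q : Mat (Multiset Z) A) (R : Mat (Multiset (Z ⊕ ℕ)) A) :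
    Mat (Multiset Z) A :=
  (sif A).comp ((tens P (tens (promo Q) (promo (cur R)))).comp
    ((tens (one _) (contr Z)).comp (contr Z)))

theorem app_ifz (P : Mat (Multiset Z) ℕ) (Q : Mat (Multiset Z) A) (R : Mat (Multiset (Z ⊕ ℕ)) A)
    (u : Z → ℝ≥0∞) (a : A) : (ifz P Q R).app (prom u) a =
      P.app (prom u) 0 * Q.app (prom u) a +
        ∑' n, P.app (prom u) (n + 1) * R.app (prom (Sum.elim u fun k => kron n k)) a := by
  rw [ifz, app_comp, app_comp, app_comp, app_contr, app_tens, app_one, app_contr, app_tens,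
    app_tens, app_promo, app_promo, app_sif]
  simp only [app_cur]

end Mat

/-! ### Logical relations between vectors and closed terms -/

/-- Vectors on the web of a type. -/
abbrev Vec (σ : Ty) : Type := (tySem σ).Web → ℝ≥0∞

/-- Kleisli matrices from a context to a type. -/
abbrev KlMat (Γ : List Ty) (σ : Ty) : Type := Mat (Multiset (ctxSem Γ).Web) (tySem σ).Web

/-- A relation at the ground type, indexed by worlds. -/
structure GroundRel where
  World : Type
  le : World → World → Prop
  le_refl : ∀ k, le k k
  le_trans : ∀ {i j k}, le i j → le j k → le i k
  later : World → World → Prop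
  later_le : ∀ {j k}, later j k → le j k
  later_trans : ∀ {i j k}, later i j → le j k → later i k
  base : World → (ℕ → ℝ≥0∞) → Term [] .nat → Prop
  base_mono : ∀ {j k x M}, le j k → base k x M → base j x M
  base_num : ∀ k n, base k (fun m => kron n m) (.num n)
  -- A reduction step uses up one unit of the world, so the reducts need only be related at `later`
  -- worlds. This makes induction over worlds available for recursion.
  base_steps : ∀ {k} {ι : Type} {M : Term [] .nat} {p : ι → ℝ≥0∞} {N : ι → Term [] .nat}
    {x : ι → ℕ → ℝ≥0∞}, Steps M p N → (∀ i j, later j k → base j (x i) (N i)) →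
    base k (fun n => ∑' i, p i * x i n) M

namespace GroundRel
variable (L : GroundRel)

/-- The extension of a relation at the ground type to all types. -/
def rel : (σ : Ty) → L.World → Vec σ → Term [] σ → Prop
  | .nat, k, x, M => L.base k x M
  | .arr σ τ, k, t, M => ∀ j, L.le j k → ∀ (y : Vec σ) (N : Term [] σ), rel σ j y N →
      rel τ j (Mat.app (A := Multiset (tySem σ).Web) (B := (tySem τ).Web) t (prom y)) (.app M N)

variable {L}

theorem rel_of_eq {σ : Ty} {k : L.World} {x y : Vec σ} {M : Term [] σ} (e : x = y)
    (h : L.rel σ k y M) : L.rel σ k x M := e ▸ h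

theorem rel_mono {σ : Ty} {j k : L.World} {x : Vec σ} {M : Term [] σ} (hj : L.le j k)
    (h : L.rel σ k x M) : L.rel σ j x M := by
  cases σ with
  | nat => exact L.base_mono hj h
  | arr σ τ => exact fun i hi => h i (L.le_trans hi hj)

/-- Induction on the type: application to an argument is an evaluation frame, hence preserves the
weighted family of reducts, and applying a matrix to a promoted vector is linear in the matrix. -/
theorem rel_steps {σ : Ty} {k : L.World} {ι : Type} {M : Term [] σ} {p : ι → ℝ≥0∞}
    {N : ι → Term [] σ} {x : ι → Vec σ} (h : Steps M p N)
    (hx : ∀ i j, L.later j k → L.rel σ j (x i) (N i)) :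
    L.rel σ k (fun a => ∑' i, p i * x i a) M := by
  induction σ generalizing k with
  | nat => exact L.base_steps h hx
  | arr σ τ _ ih =>
    intro j hj y A hy
    refine rel_of_eq (Mat.app_tsum p x (prom y)) ?_
    refine ih (h.frame (Frame.app A)) fun i j' hj' => ?_
    exact hx i j' (L.later_trans hj' hj) j' (L.le_refl j') y A (rel_mono (L.later_le hj') hy)

theorem rel_steps_one {σ : Ty} {k : L.World} {M N : Term [] σ} {x : Vec σ}
    (h : Steps M (fun _ : Unit => 1) fun _ => N) (hx : ∀ j, L.later j k → L.rel σ j x N) :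
    L.rel σ k x M := by
  have := rel_steps (x := fun _ => x) h fun _ => hx
  simpa using this

variable (L) in
/-- Relatedness of an environment and a closing substitution. -/
def env {Γ : List Ty} (k : L.World) (s : Sub Γ []) (u : (ctxSem Γ).Web → ℝ≥0∞) : Prop :=
  ∀ τ (v : Var Γ τ), L.rel τ k (v.proj.1.app u) (s τ v)

theorem env_mono {Γ : List Ty} {j k : L.World} {s : Sub Γ []} {u : (ctxSem Γ).Web → ℝ≥0∞}
    (hj : L.le j k) (h : L.env k s u) : L.env j s u := fun τ v => rel_mono hj (h τ v)

end GroundRel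

theorem app_fst {X Y : PCS} (u : (prod X Y).Web → ℝ≥0∞) :
    (fst X Y).1.app u = fun a => u (Sum.inl a) :=
  funext fun a => tsum_kron (Sum.inl a) u

theorem app_snd {X Y : PCS} (u : (prod X Y).Web → ℝ≥0∞) :
    (snd X Y).1.app u = fun a => u (Sum.inr a) :=
  funext fun a => tsum_kron (Sum.inr a) u

theorem Var.app_proj_zero {Γ : List Ty} {σ : Ty} (u : (ctxSem (σ :: Γ)).Web → ℝ≥0∞) :
    (Var.zero : Var (σ :: Γ) σ).proj.1.app u = fun a => u (Sum.inr a) :=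
  app_snd (X := ctxSem Γ) (Y := tySem σ) u

theorem Var.app_proj_succ {Γ : List Ty} {σ τ : Ty} (v : Var Γ σ)
    (u : (ctxSem (τ :: Γ)).Web → ℝ≥0∞) :
    (Var.succ v : Var (τ :: Γ) σ).proj.1.app u = v.proj.1.app fun a => u (Sum.inl a) := by
  rw [← app_fst (X := ctxSem Γ) (Y := tySem τ) u]
  exact Mat.app_comp _ _ _

/-! ### The fundamental lemma, one term constructor at a time -/

namespace GroundRel
variable {L : GroundRel}

theorem env_cons {Γ : List Ty} {σ : Ty} {k : L.World} {s : Sub Γ []}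
    {u : (ctxSem Γ).Web → ℝ≥0∞} {y : Vec σ} {N : Term [] σ} (h : L.env k s u)
    (hy : L.rel σ k y N) :
    L.env (Γ := σ :: Γ) k (Sub.cons N s) (Sum.elim u y) := by
  intro τ v
  cases v with
  | zero => exact rel_of_eq (Var.app_proj_zero _) hy
  | succ v => exact rel_of_eq (Var.app_proj_succ v _) (h τ v)

variable (L) in
/-- The adequacy of a Kleisli matrix for an open term with respect to a logical relation. -/
def Valid {Γ : List Ty} {σ : Ty} (M : Term Γ σ) (f : KlMat Γ σ) : Prop :=
  ∀ k (s : Sub Γ []) u, L.env k s u → L.rel σ k (f.app (prom u)) (M.subst s)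

variable (L) in
/-- Compatibility with evaluation frames at the ground type and with fixpoints. -/
structure Compat : Prop where
  frame : ∀ {k σ} {F : Term [] .nat → Term [] σ} {v : ℕ → Vec σ} {x : ℕ → ℝ≥0∞} {M}, Frame F →
    (∀ n, L.rel σ k (v n) (F (.num n))) → L.base k x M →
    L.rel σ k (fun a => ∑' n, x n * v n a) (F M)
  fix : ∀ {k σ} {t : Vec (.arr σ σ)} {M : Term [] (.arr σ σ)}, L.rel (.arr σ σ) k t M →
    L.rel σ k ((Mat.sfix (tySem σ).Web).app (prom t)) (.fix M)

variable {Γ : List Ty} {σ τ : Ty}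

theorem Valid.num (n : ℕ) :
    L.Valid (.num (Γ := Γ) n) (Mat.const (B := ℕ) fun k => kron n k) := by
  intro k s u _
  exact rel_of_eq (Mat.app_const _ u) (L.base_num k n)

theorem Valid.dice (p : Set.Icc (0 : ℚ) 1) :
    L.Valid (.dice (Γ := Γ) p) (Mat.const (B := ℕ) (diceVec p)) := by
  intro k s u _
  refine rel_of_eq (Mat.app_const _ u) ?_
  have := L.base_steps (k := k) (Steps.dice p) (x := fun n m => kron n m)
    fun n j _ => L.base_num j n
  -- A distribution is the mixture, with its own weights, of the point masses.
  have e : (fun m => ∑' n, diceVec p n * kron n m) = diceVec p := by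
    funext m
    simp only [mul_comm (diceVec p _)]
    exact tsum_kron m _
  rwa [e] at this

theorem Valid.var (v : Var Γ σ) : L.Valid (.var v) (v.proj.1.comp (Mat.der _)) := by
  intro k s u h
  rw [Mat.app_comp, Mat.app_der]
  exact h σ v

/-- The application of the abstraction is a beta-redex, so it suffices that its reduct, the body
under the extended substitution, is related at all later worlds. -/
theorem Valid.lam {M : Term (σ :: Γ) τ} {f : KlMat (σ :: Γ) τ} (hM : L.Valid M f) :
    L.Valid (.lam σ M) (Mat.cur (Z := (ctxSem Γ).Web) (A := (tySem σ).Web) f) := by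
  intro k s u h j hj y N hy
  refine rel_of_eq (Mat.app_cur _ u y) ?_
  refine rel_steps_one (Steps.beta _ _) fun i hi => ?_
  rw [Term.subst_lift_subst1]
  refine hM i _ _ (env_mono (L.later_le hi) (env_cons (env_mono hj h) hy))

theorem Valid.app {M : Term Γ (.arr σ τ)} {N : Term Γ σ} {f : KlMat Γ (.arr σ τ)}
    {g : KlMat Γ σ} (hM : L.Valid M f) (hN : L.Valid N g) :
    L.Valid (.app M N) (Mat.kapp (A := (tySem σ).Web) (B := (tySem τ).Web) f g) := by
  intro k s u h
  refine rel_of_eq (Mat.app_kapp _ _ u) ?_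
  exact hM k s u h k (L.le_refl k) _ _ (hN k s u h)

theorem Valid.fix (hL : L.Compat) {M : Term Γ (.arr σ σ)} {f : KlMat Γ (.arr σ σ)}
    (hM : L.Valid M f) : L.Valid (.fix M) ((Mat.sfix (tySem σ).Web).comp (Mat.promo f)) := by
  intro k s u h
  refine rel_of_eq ((Mat.app_comp _ _ _).trans (congrArg _ (Mat.app_promo _ u))) ?_
  exact hL.fix (hM k s u h)

theorem Valid.succ (hL : L.Compat) {M : Term Γ .nat} {f : KlMat Γ .nat}
    (hM : L.Valid M f) : L.Valid (.succ M) (Mat.ssuc.comp f) := by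
  intro k s u h
  refine rel_of_eq (Mat.app_comp _ _ _) ?_
  have := hL.frame (σ := .nat) Frame.succ (v := fun n m => kron (n + 1) m)
    (fun n => rel_steps_one (Steps.succ n) fun j _ => L.base_num j (n + 1)) (hM k s u h)
  refine rel_of_eq ?_ this
  funext m
  exact tsum_congr fun n => mul_comm _ _

theorem Valid.ifz (hL : L.Compat) {M : Term Γ .nat} {P : Term Γ σ} {R : Term (.nat :: Γ) σ}
    {f : KlMat Γ .nat} {g : KlMat Γ σ} {r : KlMat (.nat :: Γ) σ}
    (hM : L.Valid M f) (hP : L.Valid P g) (hR : L.Valid R r) :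
    L.Valid (.ifz M P R) (Mat.ifz (Z := (ctxSem Γ).Web) f g r) := by
  intro k s u h
  -- The value of the conditional when the scrutinee is `n`. The conditional is the mixture of these
  -- values weighted by the denotation of the scrutinee, which is the shape required by
  -- `Compat.frame`.
  let v : ℕ → Vec σ := fun n => Nat.casesOn n (g.app (prom u)) fun n =>
    Mat.app (A := Multiset ((ctxSem Γ).Web ⊕ ℕ)) r (prom (Sum.elim u fun m => kron n m))
  have := hL.frame (Frame.ifz (P.subst s) (R.subst s.lift)) (x := f.app (prom u)) (k := k) (v := v)
    (fun n => by
      cases n with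
      | zero =>
        exact rel_steps_one (Steps.ifZero _ _) fun j hj => rel_mono (L.later_le hj) (hP k s u h)
      | succ n =>
        refine rel_steps_one (Steps.ifSucc n _ _) fun j hj => ?_
        rw [Term.subst_lift_subst1]
        exact hR j _ _ (env_cons (σ := .nat) (env_mono (L.later_le hj) h) (L.base_num j n)))
    (hM k s u h)
  refine rel_of_eq (funext fun a => (Mat.app_ifz _ _ _ u a).trans ?_) this
  exact (tsum_eq_zero_add' (f := fun n => f.app (prom u) n * v n a) ENNReal.summable).symm

theorem valid_sem (hL : L.Compat) : {Γ : List Ty} → {σ : Ty} → (M : Term Γ σ) →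
    L.Valid M M.sem.1
  | _, _, .num n => .num n
  | _, _, .var v => .var v
  | _, _, .succ M => .succ hL (valid_sem hL M)
  | _, _, .ifz M P R => .ifz hL (valid_sem hL M) (valid_sem hL P) (valid_sem hL R)
  | _, _, .lam _ M => .lam (valid_sem hL M)
  | _, _, .app M N => .app (valid_sem hL M) (valid_sem hL N)
  | _, _, .dice p => .dice p
  | _, _, .fix M => .fix hL (valid_sem hL M)

end GroundRel
-- First-step decomposition of a mixture of vectors weighted by the probabilities of reaching each
-- numeral; both frame lemmas unfold one step of the scrutinee with it.
theorem tsum_row (M : Term [] .nat) {B : Type} (v : ℕ → B → ℝ≥0∞) (k : ℕ) (b : B) :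
    ∑' X, redMat [] .nat M X * ∑' n, pr k X n * v n b = ∑' n, pr (k + 1) M n * v n b := by
  simp only [pr_succ, row, ← ENNReal.tsum_mul_left, ← ENNReal.tsum_mul_right]
  rw [ENNReal.tsum_comm]
  exact tsum_congr fun i => tsum_congr fun a => by ring

/-! ### Soundness -/

/-- The vector bounds from above the probabilities of convergence in at most `k` steps. -/
def upperRel : GroundRel where
  World := ℕ
  le := (· ≤ ·)
  le_refl := le_refl
  le_trans := le_trans
  later := (· < ·)
  later_le := le_of_lt
  later_trans := lt_of_lt_of_le
  base k x M := ∀ n, pr k M n ≤ x n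
  base_mono hj h n := (pr_mono _ n hj).trans (h n)
  base_num k n m := (pr_num k n m).le
  base_steps := by
    -- At world `0` there is no later world and nothing is known about the reducts, but a reducible
    -- term reaches a numeral in zero steps with probability `0`.
    rintro (_ | k) ι M p N x h hx n
    · rw [pr_zero h.red]; exact zero_le
    · rw [pr_succ, h.row_eq]
      exact ENNReal.tsum_le_tsum fun i => mul_le_mul' le_rfl (hx i k k.lt_succ_self n)

theorem upperRel_of_le {σ : Ty} {k : ℕ} {x y : Vec σ} {M : Term [] σ} (hxy : x ≤ y)
    (h : upperRel.rel σ k x M) : upperRel.rel σ k y M := by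
  induction σ generalizing k with
  | nat => exact fun n => (h n).trans (hxy n)
  | arr σ τ _ ih => exact fun j hj z N hz => ih (Mat.app_mono hxy le_rfl) (h j hj z N hz)

/-- The least admissible weights, the probabilities within `k` steps, are treated first; upward
closure then gives the general case. Induction on `k` unfolds reductions of the scrutinee until it
is a numeral or the steps run out. -/
theorem upperRel_frame {k : ℕ} {σ : Ty} {F : Term [] .nat → Term [] σ} {v : ℕ → Vec σ}
    {M : Term [] .nat} (hF : Frame F) (hv : ∀ n, upperRel.rel σ k (v n) (F (.num n))) :
    upperRel.rel σ k (fun a => ∑' n, pr k M n * v n a) (F M) := by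
  rcases closed_nat_cases M with hM | ⟨m, rfl⟩
  · induction k generalizing M with
    | zero =>
      -- With no later world the reducts may be given the zero vector, and upward closure concludes.
      refine upperRel_of_le (fun _ => ?_) (GroundRel.rel_steps (L := upperRel) (k := (0 : ℕ))
        (x := fun _ _ => 0) ((Steps.self hM).frame hF) fun _ j hj => absurd hj (Nat.not_lt_zero j))
      simp
    | succ k ih =>
      refine GroundRel.rel_of_eq (funext fun a => (tsum_row M v k a).symm) ?_
      refine GroundRel.rel_steps ((Steps.self hM).frame hF) fun X j hj => ?_
      have hv' : ∀ n, upperRel.rel σ k (v n) (F (.num n)) := fun n =>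
        GroundRel.rel_mono (L := upperRel) k.le_succ (hv n)
      refine GroundRel.rel_mono (L := upperRel) (Nat.le_of_lt_succ hj) ?_
      rcases closed_nat_cases X with hX | ⟨m, rfl⟩
      · exact ih hv' hX
      · simpa only [pr_num, tsum_kron'] using hv' m
  · simpa only [pr_num, tsum_kron'] using hv m

theorem upperRel_compat : upperRel.Compat where
  frame hF hv h := upperRel_of_le
    (fun _ => ENNReal.tsum_le_tsum fun n => mul_le_mul' (h n) le_rfl) (upperRel_frame hF hv)
  fix {k σ t M} h := by
    -- Unfolding `fix` costs a step, so strong induction on the world supplies the recursive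
    -- argument. Only the fixed-point equation is used, not minimality.
    have key : ∀ j : ℕ, Nat.le j k →
        upperRel.rel σ j ((Mat.sfix (tySem σ).Web).app (prom t)) (.fix M) := by
      intro j
      induction j using Nat.strong_induction_on with
      | _ j ih =>
        intro hj
        refine GroundRel.rel_steps_one (Steps.fix M) fun i hi => ?_
        have hik : Nat.le i k := (le_of_lt hi).trans hj
        exact GroundRel.rel_of_eq (Mat.app_sfix_eq t).symm (h i hik _ _ (ih i hi hik))
    exact key k (Nat.le_refl k)

/-! ### Adequacy -/

/-- The vector bounds from below the probabilities of convergence. -/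
def lowerRel : GroundRel where
  World := Unit
  le _ _ := True
  le_refl _ := trivial
  le_trans _ _ := trivial
  -- No step counting is needed here: limit probabilities satisfy the first-step equation exactly,
  -- and recursion is handled by approximants.
  later _ _ := True
  later_le _ := trivial
  later_trans _ _ := trivial
  base _ x M := ∀ n, x n ≤ prInf M n
  base_mono _ h := h
  base_num k n m := (pr_num 0 n m).ge.trans (le_iSup (fun k => pr k (.num n) m) 0)
  base_steps {k} _ _ _ _ _ h hx n := by
    rw [← h.prInf]
    exact ENNReal.tsum_le_tsum fun i => mul_le_mul' le_rfl (hx i k trivial n)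

theorem lowerRel_of_le {σ : Ty} {k : Unit} {x y : Vec σ} {M : Term [] σ} (hxy : x ≤ y)
    (h : lowerRel.rel σ k y M) : lowerRel.rel σ k x M := by
  induction σ generalizing k with
  | nat => exact fun n => (hxy n).trans (h n)
  | arr σ τ _ ih => exact fun j hj z N hz => ih (Mat.app_mono hxy le_rfl) (h j hj z N hz)

theorem lowerRel_zero {σ : Ty} (k : Unit) (M : Term [] σ) :
    lowerRel.rel σ k (fun _ => 0) M := by
  induction σ generalizing k with
  | nat => exact fun n => zero_le
  | arr σ τ _ ih =>
    intro j _ z N _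
    exact GroundRel.rel_of_eq (funext fun b => by simp [Mat.app]) (ih j (.app M N))

/-- Admissibility: a supremum of lower bounds is a lower bound, and at arrow types application is
continuous in the matrix. -/
theorem lowerRel_iSup {σ : Ty} {k : Unit} {x : ℕ → Vec σ} (hx : Monotone x) {M : Term [] σ}
    (h : ∀ i, lowerRel.rel σ k (x i) M) : lowerRel.rel σ k (fun a => ⨆ i, x i a) M := by
  induction σ generalizing k with
  | nat => exact fun n => iSup_le fun i => h i n
  | arr σ τ _ ih =>
    intro j hj z N hz
    exact GroundRel.rel_of_eq (Mat.app_iSup_left hx _)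
      (ih (fun i i' hi => Mat.app_mono (hx hi) le_rfl) fun i => h i j hj z N hz)

/-- Limit weights cannot be reached by an induction on steps, so the statement is proved for each
finite stage `i`; `lowerRel_compat` passes to the supremum. -/
theorem lowerRel_frame {k : Unit} {σ : Ty} {F : Term [] .nat → Term [] σ} {v : ℕ → Vec σ}
    {M : Term [] .nat} (hF : Frame F) (hv : ∀ n, lowerRel.rel σ k (v n) (F (.num n))) (i : ℕ) :
    lowerRel.rel σ k (fun a => ∑' n, pr i M n * v n a) (F M) := by
  induction i generalizing M with
  | zero =>
    rcases closed_nat_cases M with hM | ⟨m, rfl⟩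
    · simpa only [pr_zero hM, zero_mul, tsum_zero] using lowerRel_zero k (F M)
    · simpa only [pr_num, tsum_kron'] using hv m
  | succ i ih =>
    rcases closed_nat_cases M with hM | ⟨m, rfl⟩
    · refine GroundRel.rel_of_eq (funext fun a => (tsum_row M v i a).symm) ?_
      exact GroundRel.rel_steps ((Steps.self hM).frame hF) fun X j _ => ih
    · simpa only [pr_num, tsum_kron'] using hv m

theorem lowerRel_compat : lowerRel.Compat where
  frame {k σ F v x M} hF hv h := by
    have h' := lowerRel_iSup (x := fun i a => ∑' n, pr i M n * v n a)
      (fun i j hij a => ENNReal.tsum_le_tsum fun n => mul_le_mul' (pr_mono M n hij) le_rfl)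
      (lowerRel_frame (M := M) hF hv)
    refine lowerRel_of_le (fun a => ?_) h'
    rw [← tsum_iSup_of_monotone (f := fun i n => pr i M n * v n a)
      fun i j hij n => mul_le_mul' (pr_mono M n hij) le_rfl]
    simp only [← ENNReal.iSup_mul]
    exact ENNReal.tsum_le_tsum fun n => mul_le_mul' (h n) le_rfl
  fix {k σ t M} h := by
    -- Here leastness matters: the fixpoint is the supremum of approximants that start at zero, and
    -- each one is related by unfolding `fix` once more.
    refine GroundRel.rel_of_eq (Mat.app_sfix t) (lowerRel_iSup (Mat.app_sfixN_mono t) fun i => ?_)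
    induction i with
    | zero =>
      exact GroundRel.rel_of_eq (funext fun b => by simp [Mat.app, Mat.sfixN])
        (lowerRel_zero k (.fix M))
    | succ i ih =>
      refine GroundRel.rel_steps_one (Steps.fix M) fun j _ => ?_
      exact GroundRel.rel_of_eq (Mat.app_sfixN_succ i t) (h j trivial _ _ ih)

/-! ### Renamings and observation contexts -/

/-- The position of the web of a variable in the web of its context. -/
def Var.idx : {Γ : List Ty} → {σ : Ty} → Var Γ σ → (tySem σ).Web → (ctxSem Γ).Web
  | _ :: _, _, .zero, a => Sum.inr a
  | _ :: _, _, .succ v, a => Sum.inl (v.idx a)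

theorem Var.app_proj : {Γ : List Ty} → {σ : Ty} → (v : Var Γ σ) → (u : (ctxSem Γ).Web → ℝ≥0∞) →
    v.proj.1.app u = fun a => u (v.idx a)
  | _ :: _, _, .zero, u => Var.app_proj_zero u
  | _ :: _, _, .succ v, u => (Var.app_proj_succ v u).trans (v.app_proj _)

/-- The action of a renaming on webs. -/
def Ren.idx : {Γ Δ : List Ty} → Ren Γ Δ → (ctxSem Γ).Web → (ctxSem Δ).Web
  | [], _, _, a => Empty.elim a
  | _ :: _, _, r, Sum.inl a => Ren.idx (fun σ v => r σ (.succ v)) a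
  | _ :: _, _, r, Sum.inr a => (r _ .zero).idx a

theorem Ren.idx_var : {Γ Δ : List Ty} → {σ : Ty} → (r : Ren Γ Δ) → (v : Var Γ σ) →
    (a : (tySem σ).Web) → r.idx (v.idx a) = (r σ v).idx a
  | _ :: _, _, _, _, .zero, _ => rfl
  | _ :: _, _, _, r, .succ v, a => Ren.idx_var (fun σ v => r σ (.succ v)) v a

namespace GroundRel

/-- Precomposition with the matrix that reindexes environments along `r`. It need not be compared
with the interpretation of the renamed term. -/
theorem Valid.rename {L : GroundRel} {Γ Δ : List Ty} {σ : Ty} (r : Ren Γ Δ) {M : Term Γ σ}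
    {f : KlMat Γ σ} (hM : L.Valid M f) :
    L.Valid (M.rename r) (f.comp (Mat.bang fun p => kron p.1 (r.idx p.2))) := by
  intro k s u h
  rw [Mat.app_comp, Mat.app_bang, Term.subst_rename]
  refine hM k _ _ fun τ v => rel_of_eq ?_ (h τ (r τ v))
  rw [Var.app_proj, Var.app_proj]
  funext a
  rw [← Ren.idx_var]
  exact tsum_kron (r.idx (v.idx a)) u

end GroundRel

/-- The order of quantifiers is the point: `g` is chosen before the relation and the filler, so one
matrix serves both bounds and both terms. Each case is the corresponding case of the fundamental
lemma, with renaming at the hole. -/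
theorem OCtx.exists_valid {Δ : Ctx} {τ : Ty} (f : KlMat Δ.types τ) : {Θ : Ctx} → {σ : Ty} →
    (C : OCtx Δ τ Θ σ) → ∃ g : KlMat Θ.types σ, ∀ L : GroundRel, L.Compat →
      ∀ M : Open Δ τ, L.Valid M f → L.Valid (C.fill M) g
  | _, _, .hole h => ⟨_, fun _ _ _ hM => hM.rename (Ctx.incl h)⟩
  | _, _, .num n => ⟨_, fun _ _ _ _ => .num n⟩
  | _, _, .var x h => ⟨_, fun _ _ _ _ => .var (Ctx.lookup _ x _ h)⟩
  | _, _, .succ C =>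
    let ⟨_, h⟩ := C.exists_valid f
    ⟨_, fun L hL M hM => .succ hL (h L hL M hM)⟩
  | _, _, .ifz C D _ _ E =>
    let ⟨_, h⟩ := C.exists_valid f
    let ⟨_, h'⟩ := D.exists_valid f
    let ⟨_, h''⟩ := E.exists_valid f
    ⟨_, fun L hL M hM => .ifz hL (h L hL M hM) (h' L hL M hM) (h'' L hL M hM)⟩
  | _, _, .lam _ _ _ C =>
    let ⟨_, h⟩ := C.exists_valid f
    ⟨_, fun L hL M hM => .lam (h L hL M hM)⟩
  | _, _, .app C D =>
    let ⟨_, h⟩ := C.exists_valid f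
    let ⟨_, h'⟩ := D.exists_valid f
    ⟨_, fun L hL M hM => .app (h L hL M hM) (h' L hL M hM)⟩
  | _, _, .dice p => ⟨_, fun _ _ _ _ => .dice p⟩
  | _, _, .fix C =>
    let ⟨_, h⟩ := C.exists_valid f
    ⟨_, fun L hL M hM => .fix hL (h L hL M hM)⟩

/-- A matrix that is adequate for a closed ground term computes its probabilities of convergence. -/
theorem prInf_eq_of_valid {M : Term [] .nat} {f : KlMat [] .nat} (hu : upperRel.Valid M f)
    (hl : lowerRel.Valid M f) (n : ℕ) : prInf M n = f.app (prom fun _ => 0) n := by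
  have hs : M.subst (fun _ v => .var v) = M := M.subst_var
  -- The empty context has no variables, so every environment is vacuously related to the identity
  -- substitution. The upper bound holds at every `k`, hence bounds the supremum.
  have hu' := fun k => hu k (fun _ v => .var v) (fun _ => 0) fun _ v => nomatch v
  have hl' := hl () (fun _ v => .var v) (fun _ => 0) fun _ v => nomatch v
  rw [hs] at hl'
  simp only [hs] at hu'
  exact le_antisymm (iSup_le fun k => hu' k n) (hl' n)

theorem obsEq_of_sem_eq {Γ : Ctx} {σ : Ty} {M M' : Open Γ σ} (h : M.sem = M'.sem) :
    ObsEq M M' := by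
  intro C
  obtain ⟨g, hg⟩ := C.exists_valid M.sem.1
  have key : ∀ N : Open Γ σ, N.sem = M.sem →
      matInf (redMat [] .nat) (C.fill N) (.num 0) = g.app (prom fun _ => 0) (0 : ℕ) := by
    intro N hN
    rw [matInf_num]
    refine prInf_eq_of_valid (hg _ upperRel_compat N ?_) (hg _ lowerRel_compat N ?_) 0
    · exact hN ▸ GroundRel.valid_sem upperRel_compat N
    · exact hN ▸ GroundRel.valid_sem lowerRel_compat N
  rw [key M rfl, key M' h.symm]

end PPCF

end

theorem mainTheorem2 (Γ : PPCF.Ctx) (hΓ : Γ.names.Nodup) (σ : PPCF.Ty) (M M' : PPCF.Open Γ σ)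
    (h : M.sem = M'.sem) : PPCF.ObsEq M M' :=
  PPCF.obsEq_of_sem_eq h
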